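/- Theorem (Verblunsky's Theorem on $\partial\mathbb{B}^d$). Let $d\ge 1$, let $\partial\mathbb{B}^d$ be the unit sphere of $\mathbb{C}^d$, and order the multi-indices $\mathbb{N}_0^d$ by the short lexicographical order $\prec$ (first by length $|\alpha|=\alpha_1+\cdots+\alpha_d$, then lexicographically with $e_1\prec e_2\prec\cdots\prec e_d$). A kernel $K:\mathbb{N}_0^d\times\mathbb{N}_0^d\to\mathbb{C}$ is positive if all its finite sections are positive semi-definite; write $\langle p,q\rangle_K=\sum_{\alpha,\beta}p_\alpha\overline{q_\beta}K(\alpha,\beta)$ for polynomials $p=\sum_\alpha p_\alpha z^\alpha$, $q=\sum_\beta q_\beta z^\beta$, and $\|p\|_K=\langle p,p\rangle_K^{1/2}$. The Verblunsky coefficients of a positive kernel $K$ are the numbers $\gamma_{\alpha,\beta}$, $\alpha\prec\beta$, determined by $$\langle p,q\rangle_K=\|p\|_K\,\gamma_{\alpha,\beta}\,\|q\|_K ,$$ with $\gamma_{\alpha,\beta}=0$ if $\|p\|_K\|q\|_K=0$, where $p$ and $q$ are the components of $z^\alpha$ and $z^\beta$ orthogonal, with respect to $\langle\cdot,\cdot\rangle_K$,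 to the span of $\{z^\delta:\alpha\prec\delta\prec\beta\}$. The moment kernel of a finite positive Borel measure $\mu$ on $\partial\mathbb{B}^d$ is $K_\mu(\alpha,\beta)=\int_{\partial\mathbb{B}^d}\zeta^\alpha\overline{\zeta}^\beta\,d\mu(\zeta)$, and the Verblunsky coefficients of $\mu$ are those of $K_\mu$. Let complex numbers $\gamma_{\alpha,\beta}$ with $|\gamma_{\alpha,\beta}|<1$ for all $\alpha\prec\beta$ in $\mathbb{N}_0^d$ and real numbers $s_\alpha>0$, $\alpha\in\mathbb{N}_0^d$, be given. Then there is a unique positive kernel $K$ on $\mathbb{N}_0^d$ with Verblunsky coefficients $(\gamma_{\alpha,\beta})$ and diagonal $K(\alpha,\alpha)=s_\alpha$ for all $\alpha$. There is a unique finite positive Borel measure $\mu$ on $\partial\mathbb{B}^d$ with Verblunsky coefficients $(\gamma_{\alpha,\beta})$ and $$\int_{\partial\mathbb{B}^d}|\zeta^\alpha|^2\,d\mu(\zeta)=s_\alpha\quad\text{for all }\alpha\in\mathbb{N}_0^d$$ if and only if $$K(\alpha,\beta)=\sum_{j=1}^d K(\alpha+e_j,\beta+e_j)\quad\text{for all }\alpha,\beta\in\mathbb{N}_0^d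 .$$ Moreover, every such measure $\mu$ has moment kernel $K$. -/

import Mathlib

namespace SphereVerblunsky

open MeasureTheory
open scoped ComplexConjugate ComplexOrder

/-- Multi-indices, the elements of `ℕ₀ᵈ`. -/
abbrev MultiIndex (d : ℕ) : Type := Fin d → ℕ

/-- The (strict) short lexicographical order on multi-indices: first by length, then
lexicographically with `e₁ ≺ e₂ ≺ ⋯ ≺ e_d`. For `d = 2` it begins
`(0,0), (1,0), (0,1), (2,0), (1,1), (0,2), …`. -/
def Shortlex {d : ℕ} (α β : MultiIndex d) : Prop :=
  ∑ i, α i < ∑ i, β i ∨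
    (∑ i, α i = ∑ i, β i ∧ ∃ i, (∀ j < i, α j = β j) ∧ β i < α i)

/-- The multi-indices lying strictly between `α` and `β`. -/
def between {d : ℕ} (α β : MultiIndex d) : Set (MultiIndex d) :=
  {δ | Shortlex α δ ∧ Shortlex δ β}

/-- Complex-valued kernels on `ℕ₀ᵈ`. -/
abbrev Kernel (d : ℕ) : Type := MultiIndex d → MultiIndex d → ℂ

/-- A kernel is positive if all its finite sections are positive semi-definite matrices. -/
def IsPositiveKernel {d : ℕ} (K : Kernel d) : Prop :=
  ∀ F : Finset (MultiIndex d),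
    (Matrix.of fun α β : F => K α.1 β.1).PosSemidef

/-- The sesquilinear form `⟨p, q⟩_K = ∑_{α,β} p_α conj(q_β) K(α, β)` on coefficient vectors of
polynomials. If `K` is the moment kernel of `μ`, then `⟨p, q⟩_K` is the inner product in `L²(μ)`
of the polynomials with coefficients `p` and `q`. -/
noncomputable def kernelForm {d : ℕ} (K : Kernel d) (p q : MultiIndex d →₀ ℂ) : ℂ :=
  p.sum fun α a => q.sum fun β b => a * conj b * K α β

/-- `p` is the component of the monomial `z^α` that is orthogonal, with respect to `K`, to the
span of the monomials `z^δ`, `δ ∈ S`. -/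
structure IsResidual {d : ℕ} (K : Kernel d) (S : Set (MultiIndex d)) (α : MultiIndex d)
    (p : MultiIndex d →₀ ℂ) : Prop where
  sub_mem : Finsupp.single α 1 - p ∈ Finsupp.supported ℂ ℂ S
  orthogonal : ∀ δ ∈ S, kernelForm K p (Finsupp.single δ 1) = 0

/-- For `α ≺ β`, the number `g` is the Verblunsky (Schur–Constantinescu) coefficient of the
positive kernel `K` at `(α, β)`. With `p` and `q` the components of `z^α` and `z^β` orthogonal to
the span of the monomials strictly between them,
`⟨p, q⟩_K = ‖p‖_K * g * ‖q‖_K`, and `g = 0` if `‖p‖_K = 0` or `‖q‖_K = 0`.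
In terms of Schur complements: if `M` is the section of `K` on the indices strictly between,
then `K(α,β) - K(α,·) M⁻¹ K(·,β) = R_α^{1/2} g R_β^{1/2}`, where
`R_x = K(x,x) - K(x,·) M⁻¹ K(·,x)`. -/
def IsVerblunskyCoeff {d : ℕ} (K : Kernel d) (α β : MultiIndex d) (g : ℂ) : Prop :=
  ∃ p q : MultiIndex d →₀ ℂ,
    IsResidual K (between α β) α p ∧ IsResidual K (between α β) β q ∧
    kernelForm K p q =
      (√(kernelForm K p p).re : ℂ) * g * (√(kernelForm K q q).re : ℂ) ∧
    ((kernelForm K p p = 0 ∨ kernelForm K q q = 0) → g = 0)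

/-- The family `(γ_{α,β})_{α ≺ β}` is the family of Verblunsky coefficients of `K`. Verblunsky
coefficients of a kernel carry information only for `α ≺ β`. -/
def HasVerblunskyCoeffs {d : ℕ} (K : Kernel d) (γ : MultiIndex d → MultiIndex d → ℂ) : Prop :=
  ∀ α β, Shortlex α β → IsVerblunskyCoeff K α β (γ α β)

/-- The unit sphere `∂𝔹ᵈ` of `ℂᵈ`. -/
abbrev UnitSphere (d : ℕ) : Type := Metric.sphere (0 : EuclideanSpace ℂ (Fin d)) 1

/-- The monomial `ζ^α = ∏ i, ζ_i ^ α_i`. -/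
noncomputable def monomial {d : ℕ} (α : MultiIndex d) (ζ : UnitSphere d) : ℂ :=
  ∏ i, (ζ : EuclideanSpace ℂ (Fin d)) i ^ α i

/-- The moment kernel `K(α, β) = ∫ ζ^α conj(ζ^β) dμ` of a measure on the unit sphere. -/
noncomputable def momentKernel {d : ℕ} (μ : Measure (UnitSphere d)) : Kernel d :=
  fun α β => ∫ ζ, monomial α ζ * conj (monomial β ζ) ∂μ

/-- `μ` is a (finite positive Borel) measure on the sphere with Verblunsky coefficients `γ`
and with `∫ |ζ^α|² dμ = s_α` for all `α`. -/
structure HasVerblunskyData {d : ℕ} (γ : MultiIndex d → MultiIndex d → ℂ) (s : MultiIndex d → ℝ)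
    (μ : Measure (UnitSphere d)) : Prop where
  finite : IsFiniteMeasure μ
  coeffs : HasVerblunskyCoeffs (momentKernel μ) γ
  diagonal : ∀ α, ∫ ζ, ‖monomial α ζ‖ ^ 2 ∂μ = s α

/-- `K` is a positive kernel with Verblunsky coefficients `γ` and diagonal `s`. -/
structure IsKernelOf {d : ℕ} (γ : MultiIndex d → MultiIndex d → ℂ) (s : MultiIndex d → ℝ)
    (K : Kernel d) : Prop where
  positive : IsPositiveKernel K
  coeffs : HasVerblunskyCoeffs K γ
  diagonal : ∀ α, K α α = s α

end SphereVerblunsky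

/-! Kernels. Suppose that `K` is known on the half-open shortlex intervals [α, β) and (α, β]. The
orthogonal components p, q of the endpoints are then known modulo null vectors, and ⟨p, q⟩ is K(α,
β) minus a quantity built from known entries (`IsOrthComponent.form_eq'`). Hence γ_{α,β} prescribes
exactly the one missing entry. Since |γ_{α,β}| < 1 is the strict Cauchy–Schwarz inequality for p and
q, the enlarged section stays definite (`PosOn.insert_insert`). Shortlex intervals are finite, so
induction on their cardinality gives existence (`SolvesUpTo.exists_succ`) and uniqueness
(`eq_of_isCoeff`).

Measures. A moment kernel satisfies the recurrence because ∑ |ζ_j|² = 1 on the sphere. Conversely,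
positive kernels that satisfy it, normalized by K(0, 0) = 1, form a compact convex set.
Multiplication by z_j is contractive for such a kernel, so an extreme point is split by positive
pieces built from z_j, each of which must be proportional to it. Polarization makes the shift by e_j
a scalar l_j, and the kernel is evaluation at l, a point of the sphere (`exists_eq_dirac`). By
Krein–Milman every normalized kernel lies in the closed convex hull of these evaluations, hence
among the moment kernels of probability measures, a compact convex set. Stone–Weierstrass gives
uniqueness of the measure. -/

namespace SphereVerblunsky

open MeasureTheory
open scoped ComplexConjugate ComplexOrder

/-! ### Sesquilinear forms of kernels and orthogonal components. -/

section SesqForm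

variable {ι : Type*}

/-- The sesquilinear form `∑ p_a conj(q_b) K(a, b)` on finitely supported vectors. -/
noncomputable def sesqForm (K : ι → ι → ℂ) (p q : ι →₀ ℂ) : ℂ :=
  p.sum fun α a => q.sum fun β b => a * conj b * K α β

/-- Hermitian symmetry of a kernel. -/
def IsHermitianKernel (K : ι → ι → ℂ) : Prop := ∀ a b, K b a = conj (K a b)

variable {K K' : ι → ι → ℂ}

@[simp] lemma sesqForm_zero_left (q : ι →₀ ℂ) : sesqForm K 0 q = 0 := by simp [sesqForm]

@[simp] lemma sesqForm_zero_right (p : ι →₀ ℂ) : sesqForm K p 0 = 0 := by simp [sesqForm]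

@[simp] lemma sesqForm_single (a b : ι) (x y : ℂ) :
    sesqForm K (Finsupp.single a x) (Finsupp.single b y) = x * conj y * K a b := by
  simp [sesqForm]

lemma sesqForm_add_left (p p' q : ι →₀ ℂ) :
    sesqForm K (p + p') q = sesqForm K p q + sesqForm K p' q := by
  classical
  unfold sesqForm
  refine Finsupp.sum_add_index' (by simp) fun a x y => ?_
  rw [← Finsupp.sum_add]
  exact Finsupp.sum_congr fun _ _ => by ring

lemma sesqForm_add_right (p q q' : ι →₀ ℂ) :
    sesqForm K p (q + q') = sesqForm K p q + sesqForm K p q' := by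
  classical
  unfold sesqForm
  rw [← Finsupp.sum_add]
  refine Finsupp.sum_congr fun a _ => ?_
  exact Finsupp.sum_add_index' (by simp) fun b x y => by simp; ring

lemma sesqForm_smul_left (c : ℂ) (p q : ι →₀ ℂ) :
    sesqForm K (c • p) q = c * sesqForm K p q := by
  unfold sesqForm
  rw [Finsupp.sum_smul_index (by simp), Finsupp.mul_sum]
  refine Finsupp.sum_congr fun a _ => ?_
  rw [Finsupp.mul_sum]
  exact Finsupp.sum_congr fun _ _ => by ring

lemma sesqForm_smul_right (c : ℂ) (p q : ι →₀ ℂ) :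
    sesqForm K p (c • q) = conj c * sesqForm K p q := by
  unfold sesqForm
  rw [Finsupp.mul_sum]
  refine Finsupp.sum_congr fun a _ => ?_
  rw [Finsupp.sum_smul_index (by simp), Finsupp.mul_sum]
  exact Finsupp.sum_congr fun _ _ => by simp; ring

lemma sesqForm_sub_left (p p' q : ι →₀ ℂ) :
    sesqForm K (p - p') q = sesqForm K p q - sesqForm K p' q := by
  rw [eq_sub_iff_add_eq, ← sesqForm_add_left, sub_add_cancel]

lemma sesqForm_sub_right (p q q' : ι →₀ ℂ) :
    sesqForm K p (q - q') = sesqForm K p q - sesqForm K p q' := by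
  rw [eq_sub_iff_add_eq, ← sesqForm_add_right, sub_add_cancel]

lemma sesqForm_congr {S T : Set ι} (h : ∀ a ∈ S, ∀ b ∈ T, K a b = K' a b) {p q : ι →₀ ℂ}
    (hp : p ∈ Finsupp.supported ℂ ℂ S) (hq : q ∈ Finsupp.supported ℂ ℂ T) :
    sesqForm K p q = sesqForm K' p q :=
  Finsupp.sum_congr fun a ha => Finsupp.sum_congr fun b hb => by
    rw [h a (hp ha) b (hq hb)]

lemma IsHermitianKernel.sesqForm_conj (hK : IsHermitianKernel K) (p q : ι →₀ ℂ) :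
    sesqForm K q p = conj (sesqForm K p q) := by
  unfold sesqForm
  rw [Finsupp.sum_comm]
  simp only [Finsupp.sum, map_sum, map_mul, Complex.conj_conj]
  exact Finset.sum_congr rfl fun a _ => Finset.sum_congr rfl fun b _ => by
    rw [hK a b]; ring

lemma IsHermitianKernel.sesqForm_self_im (hK : IsHermitianKernel K) (p : ι →₀ ℂ) :
    (sesqForm K p p).im = 0 :=
  Complex.conj_eq_iff_im.1 (hK.sesqForm_conj p p).symm

lemma IsHermitianKernel.sesqForm_self_re (hK : IsHermitianKernel K) (p : ι →₀ ℂ) :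
    ((sesqForm K p p).re : ℂ) = sesqForm K p p :=
  Complex.ext rfl (by simp [hK.sesqForm_self_im p])

lemma IsHermitianKernel.apply_self_im (hK : IsHermitianKernel K) (a : ι) : (K a a).im = 0 :=
  Complex.conj_eq_iff_im.1 (hK a a).symm

/-- Null vectors of a semi-definite form are orthogonal to everything. -/
lemma IsHermitianKernel.sesqForm_eq_zero (hK : IsHermitianKernel K) {S : Set ι}
    (hS : ∀ f ∈ Finsupp.supported ℂ ℂ S, 0 ≤ (sesqForm K f f).re) {u v : ι →₀ ℂ}
    (hu : u ∈ Finsupp.supported ℂ ℂ S) (hv : v ∈ Finsupp.supported ℂ ℂ S)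
    (h0 : sesqForm K u u = 0) : sesqForm K u v = 0 := by
  set w := sesqForm K u v with hw
  -- Test the form on v - R w̄ u. As ⟨u, u⟩ = 0 the result is affine in R, so it can stay
  -- nonnegative for all R only if w = 0.
  have key : ∀ R : ℝ, 0 ≤ (sesqForm K v v).re - 2 * R * Complex.normSq w := by
    intro R
    have := hS (v + (-(R * conj w)) • u) (Submodule.add_mem _ hv (Submodule.smul_mem _ _ hu))
    simp only [sesqForm_add_left, sesqForm_add_right, sesqForm_smul_left, sesqForm_smul_right,
      h0, hK.sesqForm_conj u v, ← hw] at this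
    simp at this
    rw [Complex.normSq_apply]
    nlinarith [this]
  by_contra hne
  have hpos := Complex.normSq_pos.2 hne
  have := key (((sesqForm K v v).re + 1) / Complex.normSq w)
  rw [mul_assoc, div_mul_cancel₀ _ hpos.ne'] at this
  have h2 := key 0
  linarith

/-- `p` is the component of the basis vector at `a` orthogonal to those indexed by `S`. -/
def IsOrthComponent (K : ι → ι → ℂ) (S : Set ι) (a : ι) (p : ι →₀ ℂ) : Prop :=
  Finsupp.single a 1 - p ∈ Finsupp.supported ℂ ℂ S ∧
    ∀ δ ∈ S, sesqForm K p (Finsupp.single δ 1) = 0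

variable {S : Set ι} {a b : ι} {p q r : ι →₀ ℂ}

lemma sesqForm_eq_zero_of_single (h : ∀ δ ∈ S, sesqForm K p (Finsupp.single δ 1) = 0)
    (hr : r ∈ Finsupp.supported ℂ ℂ S) : sesqForm K p r = 0 := by
  rw [Finsupp.supported_eq_span_single] at hr
  induction hr using Submodule.span_induction with
  | mem x hx => obtain ⟨δ, hδ, rfl⟩ := hx; exact h δ hδ
  | zero => simp
  | add x y _ _ hx hy => rw [sesqForm_add_right, hx, hy, add_zero]
  | smul c x _ hx => rw [sesqForm_smul_right, hx, mul_zero]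

lemma IsOrthComponent.orth (hp : IsOrthComponent K S a p)
    (hr : r ∈ Finsupp.supported ℂ ℂ S) : sesqForm K p r = 0 :=
  sesqForm_eq_zero_of_single hp.2 hr

lemma IsOrthComponent.mem_supported (hp : IsOrthComponent K S a p) :
    p ∈ Finsupp.supported ℂ ℂ (insert a S) := by
  have h1 : Finsupp.single a (1 : ℂ) ∈ Finsupp.supported ℂ ℂ (insert a S) :=
    Finsupp.single_mem_supported ℂ 1 (Set.mem_insert a S)
  have := Submodule.sub_mem _ h1 (Finsupp.supported_mono (Set.subset_insert a S) hp.1)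
  simpa using this

lemma IsOrthComponent.apply_self (hp : IsOrthComponent K S a p) (ha : a ∉ S) : p a = 1 := by
  have := (Finsupp.mem_supported' ℂ _).1 hp.1 a ha
  simp [sub_eq_zero] at this
  exact this.symm

lemma IsOrthComponent.form_eq (hp : IsOrthComponent K S a p) (hq : IsOrthComponent K S b q) :
    sesqForm K p q = sesqForm K p (Finsupp.single b 1) := by
  have := hp.orth hq.1
  rw [sesqForm_sub_right, sub_eq_zero] at this
  exact this.symm

/-- Isolates the corner entry: the subtracted term pairs a vector supported in `S` with `b`, so for
`a` outside `S` it does not involve `K a b`. Prescribing ⟨p, q⟩ thus amounts to prescribing `K a b`.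
-/
lemma IsOrthComponent.form_eq' (hp : IsOrthComponent K S a p) (hq : IsOrthComponent K S b q) :
    sesqForm K p q = K a b - sesqForm K (Finsupp.single a 1 - p) (Finsupp.single b 1) := by
  rw [hp.form_eq hq, sesqForm_sub_left]
  simp

lemma IsOrthComponent.congr (hp : IsOrthComponent K S a p)
    (h : ∀ x ∈ insert a S, ∀ y ∈ S, K x y = K' x y) : IsOrthComponent K' S a p :=
  ⟨hp.1, fun δ hδ => by
    rw [← hp.2 δ hδ]
    exact (sesqForm_congr h hp.mem_supported (Finsupp.single_mem_supported ℂ 1 hδ)).symm⟩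

/-- The difference of two orthogonal components of the same vector is a null vector. -/
lemma IsOrthComponent.sub_null {p' : ι →₀ ℂ} (hp : IsOrthComponent K S a p)
    (hp' : IsOrthComponent K S a p') :
    p - p' ∈ Finsupp.supported ℂ ℂ S ∧ sesqForm K (p - p') (p - p') = 0 := by
  have h1 : p - p' ∈ Finsupp.supported ℂ ℂ S := by
    have := Submodule.sub_mem _ hp'.1 hp.1
    simpa using this
  refine ⟨h1, ?_⟩
  rw [sesqForm_sub_left, hp.orth h1, hp'.orth h1, sub_zero]

/-- Over a merely semi-definite form the orthogonal component need not be unique, but two choices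
differ by a null vector, which is orthogonal to everything. The norm is therefore well defined. -/
lemma IsOrthComponent.form_self_eq {p' : ι →₀ ℂ} (hK : IsHermitianKernel K)
    (hS : ∀ f ∈ Finsupp.supported ℂ ℂ (insert a S), 0 ≤ (sesqForm K f f).re)
    (hp : IsOrthComponent K S a p) (hp' : IsOrthComponent K S a p') :
    sesqForm K p p = sesqForm K p' p' := by
  obtain ⟨h1, h2⟩ := hp.sub_null hp'
  have h3 : sesqForm K (p - p') (Finsupp.single a 1) = 0 :=
    hK.sesqForm_eq_zero hS (Finsupp.supported_mono (Set.subset_insert a S) h1)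
      (Finsupp.single_mem_supported ℂ 1 (Set.mem_insert a S)) h2
  rw [hp.form_eq hp, hp'.form_eq hp']
  rwa [sesqForm_sub_left, sub_eq_zero] at h3

/-- Orthogonal components exist with respect to a finite set on which the form is definite. -/
lemma exists_isOrthComponent (S : Finset ι)
    (hS : ∀ f ∈ Finsupp.supported ℂ ℂ (S : Set ι), f ≠ 0 → 0 < (sesqForm K f f).re) (a : ι) :
    ∃ p, IsOrthComponent K S a p := by
  -- The Gram map of `S`: definiteness makes it injective, equality of dimensions makes it
  -- surjective, and the projection of `a` solves the resulting normal equations.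
  let T : Finsupp.supported ℂ ℂ (S : Set ι) →ₗ[ℂ] (S → ℂ) :=
    { toFun := fun c δ => sesqForm K c.1 (Finsupp.single δ.1 1)
      map_add' := fun x y => by ext δ; exact sesqForm_add_left _ _ _
      map_smul' := fun c x => by ext δ; exact sesqForm_smul_left _ _ _ }
  have hinj : Function.Injective T := by
    rw [injective_iff_map_eq_zero]
    intro c hc
    by_contra hne
    have h0 : sesqForm K c.1 c.1 = 0 :=
      sesqForm_eq_zero_of_single (fun δ hδ => congrFun hc ⟨δ, hδ⟩) c.2
    have := hS c.1 c.2 (by simpa using hne)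
    simp [h0] at this
  let e : Finsupp.supported ℂ ℂ (S : Set ι) ≃ₗ[ℂ] (S →₀ ℂ) := Finsupp.supportedEquivFinsupp _
  have : FiniteDimensional ℂ (Finsupp.supported ℂ ℂ (S : Set ι)) :=
    Module.Finite.equiv e.symm
  have hsurj : Function.Surjective T :=
    (LinearMap.injective_iff_surjective_of_finrank_eq_finrank (by
      rw [e.finrank_eq]; simp)).1 hinj
  obtain ⟨c, hc⟩ := hsurj fun δ => sesqForm K (Finsupp.single a 1) (Finsupp.single δ.1 1)
  refine ⟨Finsupp.single a 1 - c.1, by simp, fun δ hδ => ?_⟩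
  rw [sesqForm_sub_left, sub_eq_zero]
  exact (congrFun hc ⟨δ, hδ⟩).symm

end SesqForm

/-! ### The inverse problem for kernels over a locally finite linear order. -/

section Order

variable {ι : Type*} {K K' : ι → ι → ℂ}

/-- The form of `K` is positive definite on vectors supported in `S`. -/
def PosOn (K : ι → ι → ℂ) (S : Set ι) : Prop :=
  ∀ f ∈ Finsupp.supported ℂ ℂ S, f ≠ 0 → 0 < (sesqForm K f f).re

/-- The form of `K` is positive semi-definite on vectors supported in `S`. -/
def NonnegOn (K : ι → ι → ℂ) (S : Set ι) : Prop :=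
  ∀ f ∈ Finsupp.supported ℂ ℂ S, 0 ≤ (sesqForm K f f).re

lemma PosOn.nonnegOn {S : Set ι} (h : PosOn K S) : NonnegOn K S := fun f hf => by
  rcases eq_or_ne f 0 with rfl | h0
  · simp
  · exact (h f hf h0).le

lemma PosOn.mono {S T : Set ι} (h : PosOn K T) (hST : S ⊆ T) : PosOn K S :=
  fun f hf => h f (Finsupp.supported_mono hST hf)

lemma NonnegOn.mono {S T : Set ι} (h : NonnegOn K T) (hST : S ⊆ T) : NonnegOn K S :=
  fun f hf => h f (Finsupp.supported_mono hST hf)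

lemma PosOn.congr {S : Set ι} (h : PosOn K S) (hKK' : ∀ a ∈ S, ∀ b ∈ S, K a b = K' a b) :
    PosOn K' S := fun f hf h0 => by
  rw [← sesqForm_congr hKK' hf hf]
  exact h f hf h0

lemma IsOrthComponent.pos {S : Set ι} {a : ι} {p : ι →₀ ℂ} (hp : IsOrthComponent K S a p)
    (ha : a ∉ S) (h : PosOn K (insert a S)) : 0 < (sesqForm K p p).re :=
  h p hp.mem_supported fun h0 => by simpa [h0] using hp.apply_self ha

/-- With P = u², Q = v², X = xu, Y = yv, the expression is (1 - g)(X² + Y²) + g(X - Y)². -/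
lemma quadratic_pos {P Q g : ℝ} (hP : 0 < P) (hQ : 0 < Q) (hg0 : 0 ≤ g) (hg : g < 1)
    {x y : ℝ} (hxy : x ≠ 0 ∨ y ≠ 0) (hx : 0 ≤ x) (hy : 0 ≤ y) :
    0 < x ^ 2 * P + y ^ 2 * Q - 2 * (x * y * (√P * g * √Q)) := by
  obtain ⟨u, hu, rfl⟩ : ∃ u, 0 < u ∧ u ^ 2 = P := ⟨√P, Real.sqrt_pos.2 hP, Real.sq_sqrt hP.le⟩
  obtain ⟨v, hv, rfl⟩ : ∃ v, 0 < v ∧ v ^ 2 = Q := ⟨√Q, Real.sqrt_pos.2 hQ, Real.sq_sqrt hQ.le⟩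
  rw [Real.sqrt_sq hu.le, Real.sqrt_sq hv.le]
  have h1 : 0 < (x * u) ^ 2 + (y * v) ^ 2 := by
    rcases hxy with h | h
    · have : 0 < (x * u) ^ 2 := by positivity
      positivity
    · have : 0 < (y * v) ^ 2 := by positivity
      positivity
  have h2 : 0 ≤ g * (x * u - y * v) ^ 2 := by positivity
  nlinarith [mul_pos (sub_pos.2 hg) h1]

/-- A form that is definite on `insert a S` and on `insert b S` is definite on their union
if the orthogonal components of `a` and `b` satisfy the strict Cauchy–Schwarz inequality. -/
lemma PosOn.insert_insert {S : Set ι} {a b : ι} (hK : IsHermitianKernel K) (haS : a ∉ S)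
    (hbS : b ∉ S) (hab : a ≠ b) (ha : PosOn K (insert a S)) (hb : PosOn K (insert b S))
    {p q : ι →₀ ℂ} (hp : IsOrthComponent K S a p) (hq : IsOrthComponent K S b q) {g : ℂ}
    (hg : ‖g‖ < 1)
    (hpq : sesqForm K p q = (√(sesqForm K p p).re : ℂ) * g * (√(sesqForm K q q).re : ℂ)) :
    PosOn K (insert a (insert b S)) := by
  intro f hf hf0
  have hP := hp.pos haS ha
  have hQ := hq.pos hbS hb
  set P := (sesqForm K p p).re with hPdef
  set Q := (sesqForm K q q).re with hQdef
  -- Since `p` and `q` have coefficient 1 at their own endpoint and 0 at the other, `r` is supported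
  -- in `S`. It is then orthogonal to both, and the form splits into a binary form in `f a`, `f b`
  -- plus ⟨r, r⟩.
  obtain ⟨r, hr⟩ : ∃ r, r = f - (f a • p + f b • q) := ⟨_, rfl⟩
  have hfr : f = f a • p + f b • q + r := by rw [hr]; abel
  have hpb : p b = 0 := (Finsupp.mem_supported' ℂ _).1 hp.mem_supported b (by
    simp [hbS, hab.symm])
  have hqa : q a = 0 := (Finsupp.mem_supported' ℂ _).1 hq.mem_supported a (by
    simp [haS, hab])
  have hrS : r ∈ Finsupp.supported ℂ ℂ S := by
    rw [Finsupp.mem_supported']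
    intro x hx
    by_cases hxa : x = a
    · subst hxa; simp [hr, hp.apply_self haS, hqa]
    by_cases hxb : x = b
    · subst hxb; simp [hr, hq.apply_self hbS, hpb]
    have h1 : f x = 0 := (Finsupp.mem_supported' ℂ _).1 hf x (by simp [hx, hxa, hxb])
    have h2 : p x = 0 := (Finsupp.mem_supported' ℂ _).1 hp.mem_supported x (by simp [hx, hxa])
    have h3 : q x = 0 := (Finsupp.mem_supported' ℂ _).1 hq.mem_supported x (by simp [hx, hxb])
    simp [hr, h1, h2, h3]
  generalize f a = x at *
  generalize f b = y at *
  have hPc := hK.sesqForm_self_re p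
  have hQc := hK.sesqForm_self_re q
  have hexp : sesqForm K f f = ((‖x‖ ^ 2 * P + ‖y‖ ^ 2 * Q : ℝ) : ℂ) +
      (x * conj y * sesqForm K p q + conj (x * conj y * sesqForm K p q)) + sesqForm K r r := by
    have h1 : sesqForm K r p = 0 := by rw [hK.sesqForm_conj p r, hp.orth hrS, map_zero]
    have h2 : sesqForm K r q = 0 := by rw [hK.sesqForm_conj q r, hq.orth hrS, map_zero]
    rw [hfr]
    simp only [sesqForm_add_left, sesqForm_add_right, sesqForm_smul_left, sesqForm_smul_right,
      hp.orth hrS, hq.orth hrS, h1, h2, hK.sesqForm_conj p q]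
    rw [← hPc, ← hQc, ← hPdef, ← hQdef]
    push_cast
    rw [← Complex.mul_conj', ← Complex.mul_conj']
    simp only [map_mul, Complex.conj_conj]
    ring
  have hre : (sesqForm K f f).re = ‖x‖ ^ 2 * P + ‖y‖ ^ 2 * Q +
      2 * (x * conj y * sesqForm K p q).re + (sesqForm K r r).re := by
    rw [hexp, Complex.add_re, Complex.add_re, Complex.ofReal_re, Complex.add_re,
      Complex.conj_re]
    ring
  have hcs : -(‖x‖ * ‖y‖ * (√P * ‖g‖ * √Q)) ≤ (x * conj y * sesqForm K p q).re := by
    have h1 := Complex.abs_re_le_norm (x * conj y * sesqForm K p q)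
    have h2 : ‖x * conj y * sesqForm K p q‖ = ‖x‖ * ‖y‖ * (√P * ‖g‖ * √Q) := by
      rw [hpq]
      simp [abs_of_nonneg (Real.sqrt_nonneg _)]
    rw [h2] at h1
    exact (abs_le.1 h1).1
  have hr0 : 0 ≤ (sesqForm K r r).re :=
    (ha.mono (Set.subset_insert a S)).nonnegOn r hrS
  by_cases hxy : x = 0 ∧ y = 0
  · have hrf : f = r := by rw [hfr, hxy.1, hxy.2]; simp
    rw [hrf]
    rw [hrf] at hf0
    exact ha r (Finsupp.supported_mono (Set.subset_insert a S) hrS) hf0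
  · have := quadratic_pos hP hQ (norm_nonneg g) hg (x := ‖x‖) (y := ‖y‖)
      (by simp only [ne_eq, norm_eq_zero]; tauto) (norm_nonneg x) (norm_nonneg y)
    rw [hre]
    linarith

/-- The entry of a kernel at `(a, b)` is determined by the entries nearer to the diagonal
together with the normalized inner product of the orthogonal components. -/
lemma apply_eq_of_isOrthComponent {S : Set ι} {a b : ι} (hK : IsHermitianKernel K)
    (ha : NonnegOn K (insert a S)) (hb : NonnegOn K (insert b S))
    (hKa : ∀ x ∈ insert a S, ∀ y ∈ insert a S, K x y = K' x y)
    (hKb : ∀ x ∈ insert b S, ∀ y ∈ insert b S, K x y = K' x y)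
    {p q p' q' : ι →₀ ℂ} (hp : IsOrthComponent K S a p) (hq : IsOrthComponent K S b q)
    (hp' : IsOrthComponent K' S a p') (hq' : IsOrthComponent K' S b q') {g : ℂ}
    (h : sesqForm K p q = (√(sesqForm K p p).re : ℂ) * g * (√(sesqForm K q q).re : ℂ))
    (h' : sesqForm K' p' q' =
      (√(sesqForm K' p' p').re : ℂ) * g * (√(sesqForm K' q' q').re : ℂ)) :
    K a b = K' a b := by
  have hp'K : IsOrthComponent K S a p' := hp'.congr fun x hx y hy =>
    (hKa x hx y (Set.subset_insert a S hy)).symm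
  have hq'K : IsOrthComponent K S b q' := hq'.congr fun x hx y hy =>
    (hKb x hx y (Set.subset_insert b S hy)).symm
  rw [← sesqForm_congr hKa hp'.mem_supported hp'.mem_supported,
    ← sesqForm_congr hKb hq'.mem_supported hq'.mem_supported,
    ← hp.form_self_eq hK ha hp'K, ← hq.form_self_eq hK hb hq'K, ← h, hp'.form_eq' hq',
    hp.form_eq' hq] at h'
  have hbS : Finsupp.single b (1 : ℂ) ∈ Finsupp.supported ℂ ℂ (insert b S) :=
    Finsupp.single_mem_supported ℂ 1 (Set.mem_insert b S)
  -- `p` and `p'` are both components for `K`, perhaps different ones. Their difference is null, so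
  -- replacing one by the other does not affect the pairing with `b`, and the two equations for the
  -- corner entry coincide.
  obtain ⟨h1, h2⟩ := hp.sub_null hp'K
  have h3 : sesqForm K (p - p') (Finsupp.single b 1) = 0 :=
    hK.sesqForm_eq_zero hb (Finsupp.supported_mono (Set.subset_insert b S) h1) hbS h2
  rw [← sesqForm_congr hKb (Finsupp.supported_mono (Set.subset_insert b S) hp'.1) hbS,
    sub_eq_iff_eq_add] at h'
  rw [sesqForm_sub_left, sub_eq_zero] at h3
  rw [sesqForm_sub_left, sesqForm_sub_left, h3] at h'
  rw [sub_add_cancel] at h'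
  exact h'.symm

variable [LinearOrder ι]

/-- The number `g` is the Verblunsky coefficient of `K` at `(a, b)`, `a < b`, for kernels indexed
by a linear order. -/
def IsCoeff (K : ι → ι → ℂ) (a b : ι) (g : ℂ) : Prop :=
  ∃ p q : ι →₀ ℂ,
    IsOrthComponent K (Set.Ioo a b) a p ∧ IsOrthComponent K (Set.Ioo a b) b q ∧
    sesqForm K p q = (√(sesqForm K p p).re : ℂ) * g * (√(sesqForm K q q).re : ℂ) ∧
    ((sesqForm K p p = 0 ∨ sesqForm K q q = 0) → g = 0)

lemma IsCoeff.congr {a b : ι} {g : ℂ} (h : IsCoeff K a b g) (hab : a < b)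
    (hKK' : ∀ x ∈ Set.Icc a b, ∀ y ∈ Set.Icc a b, K x y = K' x y) : IsCoeff K' a b g := by
  obtain ⟨p, q, hp, hq, h1, h2⟩ := h
  have hIa : insert a (Set.Ioo a b) ⊆ Set.Icc a b :=
    Set.insert_subset ⟨le_rfl, hab.le⟩ Set.Ioo_subset_Icc_self
  have hIb : insert b (Set.Ioo a b) ⊆ Set.Icc a b :=
    Set.insert_subset ⟨hab.le, le_rfl⟩ Set.Ioo_subset_Icc_self
  have hpS := Finsupp.supported_mono (R := ℂ) (M := ℂ) hIa hp.mem_supported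
  have hqS := Finsupp.supported_mono (R := ℂ) (M := ℂ) hIb hq.mem_supported
  refine ⟨p, q, hp.congr fun x hx y hy => hKK' x (hIa hx) y (Set.Ioo_subset_Icc_self hy),
    hq.congr fun x hx y hy => hKK' x (hIb hx) y (Set.Ioo_subset_Icc_self hy), ?_⟩
  rw [← sesqForm_congr hKK' hpS hqS, ← sesqForm_congr hKK' hpS hpS,
    ← sesqForm_congr hKK' hqS hqS]
  exact ⟨h1, h2⟩

lemma IsCoeff.apply_eq {a b : ι} {g : ℂ} (hab : a < b) (hK : IsHermitianKernel K)
    (ha : NonnegOn K (Set.Ico a b)) (hb : NonnegOn K (Set.Ioc a b))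
    (hKa : ∀ x ∈ Set.Ico a b, ∀ y ∈ Set.Ico a b, K x y = K' x y)
    (hKb : ∀ x ∈ Set.Ioc a b, ∀ y ∈ Set.Ioc a b, K x y = K' x y)
    (h : IsCoeff K a b g) (h' : IsCoeff K' a b g) : K a b = K' a b := by
  obtain ⟨p, q, hp, hq, h, -⟩ := h
  obtain ⟨p', q', hp', hq', h', -⟩ := h'
  rw [← Set.Ioo_insert_left hab] at ha hKa
  rw [← Set.Ioo_insert_right hab] at hb hKb
  exact apply_eq_of_isOrthComponent hK ha hb hKa hKb hp hq hp' hq' h h'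

/-- A finite set whose extreme elements span a short interval is covered by that interval. -/
lemma PosOn.of_forall_Icc {S : Set ι} (hS : S.Finite)
    (h : ∀ a ∈ S, ∀ b ∈ S, PosOn K (Set.Icc a b)) : PosOn K S := by
  rcases S.eq_empty_or_nonempty with rfl | hne
  · intro f hf h0
    simp at hf
    exact absurd hf h0
  · obtain ⟨a, ha, ha'⟩ := Set.exists_min_image S id hS hne
    obtain ⟨b, hb, hb'⟩ := Set.exists_max_image S id hS hne
    exact (h a ha b hb).mono fun x hx => ⟨ha' x hx, hb' x hx⟩

variable [LocallyFiniteOrder ι]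

/-- `K` solves the inverse problem for the data `γ`, `s` on all intervals with at most `n`
elements. -/
structure SolvesUpTo (γ : ι → ι → ℂ) (s : ι → ℝ) (n : ℕ) (K : ι → ι → ℂ) : Prop where
  hermitian : IsHermitianKernel K
  diagonal : ∀ a, K a a = s a
  pos : ∀ a b, (Finset.Icc a b).card ≤ n → PosOn K (Set.Icc a b)
  coeff : ∀ a b, a < b → (Finset.Icc a b).card ≤ n → IsCoeff K a b (γ a b)

variable {γ : ι → ι → ℂ} {s : ι → ℝ} {n m : ℕ}

lemma card_Icc_lt_of_mem_Ico {a b x y : ι} (hab : a < b) (hx : x ∈ Set.Ico a b)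
    (hy : y ∈ Set.Ico a b) : (Finset.Icc x y).card < (Finset.Icc a b).card := by
  refine Finset.card_lt_card (Finset.ssubset_iff_of_subset
    (Finset.Icc_subset_Icc hx.1 hy.2.le) |>.2 ⟨b, by simp [hab.le], ?_⟩)
  simp only [Finset.mem_Icc, not_and, not_le]
  exact fun _ => hy.2

lemma card_Icc_lt_of_mem_Ioc {a b x y : ι} (hab : a < b) (hx : x ∈ Set.Ioc a b)
    (hy : y ∈ Set.Ioc a b) : (Finset.Icc x y).card < (Finset.Icc a b).card := by
  refine Finset.card_lt_card (Finset.ssubset_iff_of_subset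
    (Finset.Icc_subset_Icc hx.1.le hy.2) |>.2 ⟨a, by simp [hab.le], ?_⟩)
  simp only [Finset.mem_Icc, not_and_or, not_le]
  exact Or.inl hx.1

/-- Two hermitian kernels with the same data, one of them positive, agree. -/
lemma eq_of_isCoeff (hK : IsHermitianKernel K) (hK' : IsHermitianKernel K')
    (hdiag : ∀ a, K a a = K' a a)
    (hpos : ∀ a b, (Finset.Icc a b).card ≤ n → NonnegOn K (Set.Icc a b))
    (hc : ∀ a b, a < b → (Finset.Icc a b).card ≤ n → IsCoeff K a b (γ a b))
    (hc' : ∀ a b, a < b → (Finset.Icc a b).card ≤ n → IsCoeff K' a b (γ a b)) :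
    ∀ a b, a ≤ b → (Finset.Icc a b).card ≤ n → K a b = K' a b := by
  intro a b hab hcard
  -- All other entries needed for (a, b) belong to pairs inside [a, b) or (a, b], whose intervals
  -- are strictly smaller.
  induction hN : (Finset.Icc a b).card using Nat.strong_induction_on generalizing a b with
  | _ N ih =>
  rcases hab.eq_or_lt with rfl | hlt
  · exact hdiag a
  have hsmall : ∀ x y, (Finset.Icc x y).card < (Finset.Icc a b).card →
      (Finset.Icc y x).card < (Finset.Icc a b).card → K x y = K' x y := by
    intro x y h1 h2
    rcases le_total x y with h | h
    · exact ih _ (hN ▸ h1) x y h (by omega) rfl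
    · rw [hK y x, hK' y x, ih _ (hN ▸ h2) y x h (by omega) rfl]
  refine IsCoeff.apply_eq hlt hK ?_ ?_ (fun x hx y hy => hsmall x y ?_ ?_)
    (fun x hx y hy => hsmall x y ?_ ?_) (hc a b hlt hcard) (hc' a b hlt hcard)
  · exact (hpos a b hcard).mono Set.Ico_subset_Icc_self
  · exact (hpos a b hcard).mono Set.Ioc_subset_Icc_self
  · exact card_Icc_lt_of_mem_Ico hlt hx hy
  · exact card_Icc_lt_of_mem_Ico hlt hy hx
  · exact card_Icc_lt_of_mem_Ioc hlt hx hy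
  · exact card_Icc_lt_of_mem_Ioc hlt hy hx

/-- Corner entries of different intervals with n + 1 elements do not interfere, because every other
pair in such an interval spans at most n elements. All of them can be replaced simultaneously. -/
lemma SolvesUpTo.exists_succ (hγ : ∀ a b, a < b → ‖γ a b‖ < 1) (hn : 1 ≤ n)
    (h : SolvesUpTo γ s n K) : ∃ K', SolvesUpTo γ s (n + 1) K' := by
  classical
  have hIco : ∀ a b, a < b → (Finset.Icc a b).card = n + 1 → PosOn K (Set.Ico a b) := by
    intro a b hab hc
    refine PosOn.of_forall_Icc (Set.finite_Ico a b) fun x hx y hy => h.pos x y ?_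
    have := card_Icc_lt_of_mem_Ico hab hx hy
    omega
  have hIoc : ∀ a b, a < b → (Finset.Icc a b).card = n + 1 → PosOn K (Set.Ioc a b) := by
    intro a b hab hc
    refine PosOn.of_forall_Icc (Set.finite_Ioc a b) fun x hx y hy => h.pos x y ?_
    have := card_Icc_lt_of_mem_Ioc hab hx hy
    omega
  have hV : ∀ a b, ∃ v : ℂ, a < b → (Finset.Icc a b).card = n + 1 →
      ∃ p q, IsOrthComponent K (Set.Ioo a b) a p ∧ IsOrthComponent K (Set.Ioo a b) b q ∧
        v - sesqForm K (Finsupp.single a 1 - p) (Finsupp.single b 1) =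
        (√(sesqForm K p p).re : ℂ) * γ a b * (√(sesqForm K q q).re : ℂ) := by
    intro a b
    by_cases hab : a < b ∧ (Finset.Icc a b).card = n + 1
    · have hS : PosOn K (Finset.Ioo a b : Finset ι) := by
        rw [Finset.coe_Ioo]
        exact (hIco a b hab.1 hab.2).mono Set.Ioo_subset_Ico_self
      obtain ⟨p, hp⟩ := exists_isOrthComponent _ hS a
      obtain ⟨q, hq⟩ := exists_isOrthComponent _ hS b
      rw [Finset.coe_Ioo] at hp hq
      exact ⟨_, fun _ _ => ⟨p, q, hp, hq, sub_eq_iff_eq_add.2 rfl⟩⟩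
    · exact ⟨0, fun h1 h2 => absurd ⟨h1, h2⟩ hab⟩
  choose V hV using hV
  -- The second branch only restores hermitian symmetry. Entries spanning more than n + 1 elements
  -- are carried over without meaning.
  let K' : ι → ι → ℂ := fun a b =>
    if a < b ∧ (Finset.Icc a b).card = n + 1 then V a b else
    if b < a ∧ (Finset.Icc b a).card = n + 1 then conj (V b a) else K a b
  have hKK' : ∀ x y, (Finset.Icc x y).card ≤ n → (Finset.Icc y x).card ≤ n →
      K x y = K' x y := by
    intro x y h1 h2
    simp only [K']
    rw [if_neg (by omega), if_neg (by omega)]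
  have hKIco : ∀ a b, a < b → (Finset.Icc a b).card = n + 1 →
      ∀ x ∈ Set.Ico a b, ∀ y ∈ Set.Ico a b, K x y = K' x y := fun a b hab hc x hx y hy => by
    have h1 := card_Icc_lt_of_mem_Ico hab hx hy
    have h2 := card_Icc_lt_of_mem_Ico hab hy hx
    exact hKK' x y (by omega) (by omega)
  have hKIoc : ∀ a b, a < b → (Finset.Icc a b).card = n + 1 →
      ∀ x ∈ Set.Ioc a b, ∀ y ∈ Set.Ioc a b, K x y = K' x y := fun a b hab hc x hx y hy => by
    have h1 := card_Icc_lt_of_mem_Ioc hab hx hy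
    have h2 := card_Icc_lt_of_mem_Ioc hab hy hx
    exact hKK' x y (by omega) (by omega)
  have hherm : IsHermitianKernel K' := by
    intro a b
    simp only [K']
    by_cases h1 : a < b ∧ (Finset.Icc a b).card = n + 1
    · rw [if_pos h1, if_neg (fun h2 => h2.1.not_gt h1.1), if_pos h1]
    · by_cases h2 : b < a ∧ (Finset.Icc b a).card = n + 1
      · rw [if_pos h2, if_neg h1, if_pos h2, Complex.conj_conj]
      · rw [if_neg h2, if_neg h1, if_neg h1, if_neg h2, h.hermitian a b]
  have hstep : ∀ a b, a < b → (Finset.Icc a b).card = n + 1 →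
      IsCoeff K' a b (γ a b) ∧ PosOn K' (Set.Icc a b) := by
    intro a b hab hc
    obtain ⟨p, q, hp, hq, hv⟩ := hV a b hab hc
    have hKa := hKIco a b hab hc
    have hKb := hKIoc a b hab hc
    have hPa := (hIco a b hab hc).congr hKa
    have hPb := (hIoc a b hab hc).congr hKb
    rw [← Set.Ioo_insert_left hab] at hKa hPa
    rw [← Set.Ioo_insert_right hab] at hKb hPb
    have hp' : IsOrthComponent K' (Set.Ioo a b) a p := hp.congr fun x hx y hy =>
      hKa x hx y (Set.mem_insert_of_mem _ hy)
    have hq' : IsOrthComponent K' (Set.Ioo a b) b q := hq.congr fun x hx y hy =>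
      hKb x hx y (Set.mem_insert_of_mem _ hy)
    have haS : a ∉ Set.Ioo a b := by simp
    have hbS : b ∉ Set.Ioo a b := by simp
    have hVab : K' a b = V a b := if_pos ⟨hab, hc⟩
    rw [← hVab, sesqForm_congr hKb (Finsupp.supported_mono (Set.subset_insert _ _) hp.1)
      (Finsupp.single_mem_supported ℂ 1 (Set.mem_insert b _)),
      sesqForm_congr hKa hp.mem_supported hp.mem_supported,
      sesqForm_congr hKb hq.mem_supported hq.mem_supported, ← hp'.form_eq' hq'] at hv
    refine ⟨⟨p, q, hp', hq', hv, ?_⟩, ?_⟩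
    · have h1 := hp'.pos haS hPa
      have h2 := hq'.pos hbS hPb
      rintro (h0 | h0)
      · simp [h0] at h1
      · simp [h0] at h2
    · have := PosOn.insert_insert hherm haS hbS hab.ne hPa hPb hp' hq' (hγ a b hab) hv
      rwa [Set.Ioo_insert_right hab, Set.Ioc_insert_left hab.le] at this
  have hKIcc : ∀ a b, (Finset.Icc a b).card ≤ n →
      ∀ x ∈ Set.Icc a b, ∀ y ∈ Set.Icc a b, K x y = K' x y := fun a b hc x hx y hy => by
    have h1 := Finset.card_le_card (Finset.Icc_subset_Icc hx.1 hy.2)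
    have h2 := Finset.card_le_card (Finset.Icc_subset_Icc hy.1 hx.2)
    exact hKK' x y (by omega) (by omega)
  refine ⟨K', hherm, fun a => ?_, fun a b hc => ?_, fun a b hab hc => ?_⟩
  · rw [← hKK' a a (by simpa using hn) (by simpa using hn), h.diagonal]
  · rcases hc.lt_or_eq with hc' | hc'
    · exact (h.pos a b (by omega)).congr (hKIcc a b (by omega))
    · refine (hstep a b ?_ hc').2
      by_contra hab
      rcases (not_lt.1 hab).eq_or_lt with rfl | hlt
      · simp at hc'; omega
      · simp [Finset.Icc_eq_empty_of_lt hlt] at hc'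
  · rcases hc.lt_or_eq with hc' | hc'
    · exact (h.coeff a b hab (by omega)).congr hab (hKIcc a b (by omega))
    · exact (hstep a b hab hc').1

lemma solvesUpTo_one (hs : ∀ a, 0 < s a) : ∃ K, SolvesUpTo γ s 1 K := by
  classical
  refine ⟨fun a b => if a = b then s a else 0, fun a b => ?_, by simp, fun a b hc => ?_,
    fun a b hab hc => ?_⟩
  · by_cases hab : a = b
    · subst hab; simp
    · simp [hab, Ne.symm hab]
  · intro f hf h0
    have hsub : Set.Icc a b ⊆ {a} := by
      intro x hx
      have hcard : (Finset.Icc a b).card ≤ 1 := hc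
      rw [Finset.card_le_one] at hcard
      exact hcard x (by simpa using hx) a (by simpa using hx.1.trans hx.2)
    have hf' := Finsupp.supported_mono (R := ℂ) (M := ℂ) hsub hf
    obtain ⟨c, rfl⟩ : ∃ c, f = Finsupp.single a c := by
      refine ⟨f a, ?_⟩
      rw [Finsupp.mem_supported] at hf'
      exact Finsupp.eq_single_iff.2 ⟨by exact_mod_cast hf', rfl⟩
    have hc0 : c ≠ 0 := by rintro rfl; simp at h0
    rw [sesqForm_single, if_pos rfl, Complex.mul_conj, ← Complex.ofReal_mul, Complex.ofReal_re]
    exact mul_pos (Complex.normSq_pos.2 hc0) (hs a)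
  · have : ({a, b} : Finset ι).card ≤ (Finset.Icc a b).card := Finset.card_le_card (by
      intro x hx
      simp only [Finset.mem_insert, Finset.mem_singleton] at hx
      rcases hx with rfl | rfl <;> simp [hab.le])
    rw [Finset.card_pair hab.ne] at this
    omega

lemma SolvesUpTo.mono (h : SolvesUpTo γ s n K) (hmn : m ≤ n) : SolvesUpTo γ s m K :=
  ⟨h.hermitian, h.diagonal, fun a b hc => h.pos a b (hc.trans hmn),
    fun a b hab hc => h.coeff a b hab (hc.trans hmn)⟩

lemma exists_solvesUpTo (hγ : ∀ a b, a < b → ‖γ a b‖ < 1) (hs : ∀ a, 0 < s a) (n : ℕ) :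
    ∃ K, SolvesUpTo γ s n K := by
  -- The induction starts at level 1, where only the diagonal is constrained.
  obtain ⟨K, hK⟩ : ∃ K, SolvesUpTo γ s (n + 1) K := by
    induction n with
    | zero => exact solvesUpTo_one hs
    | succ n ih => obtain ⟨K, hK⟩ := ih; exact hK.exists_succ hγ (by omega)
  exact ⟨K, hK.mono (Nat.le_succ n)⟩

lemma SolvesUpTo.apply_eq (h : SolvesUpTo γ s n K) (h' : SolvesUpTo γ s m K') {a b : ι}
    (hn : (Finset.uIcc a b).card ≤ n) (hm : (Finset.uIcc a b).card ≤ m) : K a b = K' a b := by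
  have h1 := h.mono (min_le_left n m)
  have h2 := h'.mono (min_le_right n m)
  have key := eq_of_isCoeff h1.hermitian h2.hermitian
    (fun a => by rw [h1.diagonal, h2.diagonal])
    (fun a b hc => (h1.pos a b hc).nonnegOn) h1.coeff h2.coeff
  rcases le_total a b with hab | hab
  · rw [Finset.uIcc_of_le hab] at hn hm
    exact key a b hab (le_min hn hm)
  · rw [Finset.uIcc_of_ge hab] at hn hm
    rw [h.hermitian b a, h'.hermitian b a, key b a hab (le_min hn hm)]

/-- Existence of a positive definite kernel with prescribed Verblunsky coefficients and
diagonal. -/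
lemma exists_kernel_of_coeff (hγ : ∀ a b, a < b → ‖γ a b‖ < 1) (hs : ∀ a, 0 < s a) :
    ∃ K, ∀ n, SolvesUpTo γ s n K := by
  choose L hL using exists_solvesUpTo (γ := γ) (s := s) hγ hs
  -- Each entry is read off at the first level that determines it. By `SolvesUpTo.apply_eq` later
  -- levels agree there, so on any interval `K` coincides with a single solution.
  let K : ι → ι → ℂ := fun a b => L (Finset.uIcc a b).card a b
  have hKL : ∀ a b, ∀ x ∈ Set.Icc a b, ∀ y ∈ Set.Icc a b,
      L (Finset.Icc a b).card x y = K x y := fun a b x hx y hy =>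
    (hL _).apply_eq (hL _)
      (Finset.card_le_card (Finset.uIcc_subset_Icc (Finset.mem_Icc.2 hx) (Finset.mem_Icc.2 hy)))
      le_rfl
  refine ⟨K, fun n => ⟨fun a b => ?_, fun a => (hL _).diagonal a, fun a b _ => ?_,
    fun a b hab _ => ?_⟩⟩
  · simp only [K]
    rw [Finset.uIcc_comm b a]
    exact (hL _).hermitian a b
  · exact ((hL _).pos a b le_rfl).congr (hKL a b)
  · exact ((hL _).coeff a b hab le_rfl).congr hab (hKL a b)

end Order

/-! ### The shortlex order, and the kernel with given coefficients. -/

variable {d : ℕ}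

/-- Multi-indices, to be ordered by the short lexicographical order. -/
def ShortlexIndex (d : ℕ) : Type := MultiIndex d

namespace ShortlexIndex

/-- The embedding of multi-indices into a lexicographic product. -/
def toLexProd (α : ShortlexIndex d) : ℕ ×ₗ Lex (Fin d → ℕᵒᵈ) :=
  -- The dual order on entries accounts for e₁ ≺ e₂: at equal length, the larger entry at the first
  -- difference comes first.
  toLex (∑ i, (α : MultiIndex d) i, toLex fun i => OrderDual.toDual ((α : MultiIndex d) i))

lemma toLexProd_injective : Function.Injective (toLexProd (d := d)) := by
  intro α β h
  have h2 := congrArg (fun x => (ofLex x).2) h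
  funext i
  exact congrFun h2 i

noncomputable instance : LinearOrder (ShortlexIndex d) :=
  LinearOrder.lift' toLexProd toLexProd_injective

lemma lt_iff (α β : ShortlexIndex d) :
    α < β ↔ Shortlex (α : MultiIndex d) (β : MultiIndex d) := by
  change toLexProd α < toLexProd β ↔ _
  rw [Prod.Lex.lt_iff]
  rfl

lemma sum_le_of_le {α β : ShortlexIndex d} (h : α ≤ β) :
    ∑ i, (α : MultiIndex d) i ≤ ∑ i, (β : MultiIndex d) i := by
  rcases h.eq_or_lt with rfl | h
  · exact le_rfl
  · rcases (lt_iff α β).1 h with h | h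
    · exact h.le
    · exact h.1.le

/-- Everything below β has length at most |β|, which bounds each entry. -/
lemma finite_Icc (α β : ShortlexIndex d) : (Set.Icc α β).Finite := by
  have hfin : (Set.Iic (fun _ : Fin d => ∑ i, (β : MultiIndex d) i)).Finite := Set.finite_Iic _
  refine hfin.subset fun δ hδ i => ?_
  exact (Finset.single_le_sum (fun j _ => Nat.zero_le _) (Finset.mem_univ i)).trans
    (sum_le_of_le hδ.2)

noncomputable instance : LocallyFiniteOrder (ShortlexIndex d) :=
  LocallyFiniteOrder.ofFiniteIcc finite_Icc

end ShortlexIndex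

lemma between_eq (α β : ShortlexIndex d) :
    @between d α β = (Set.Ioo α β : Set (ShortlexIndex d)) := by
  refine Set.ext fun (δ : ShortlexIndex d) => ?_
  exact and_congr (ShortlexIndex.lt_iff α δ).symm (ShortlexIndex.lt_iff δ β).symm

lemma isVerblunskyCoeff_iff (K : Kernel d) (α β : ShortlexIndex d) (g : ℂ) :
    @IsVerblunskyCoeff d K α β g ↔ IsCoeff (ι := ShortlexIndex d) K α β g := by
  constructor
  · rintro ⟨p, q, ⟨hp1, hp2⟩, ⟨hq1, hq2⟩, h1, h2⟩
    rw [between_eq] at hp1 hp2 hq1 hq2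
    exact ⟨p, q, ⟨hp1, hp2⟩, ⟨hq1, hq2⟩, h1, h2⟩
  · rintro ⟨p, q, ⟨hp1, hp2⟩, ⟨hq1, hq2⟩, h1, h2⟩
    rw [← between_eq] at hp1 hp2 hq1 hq2
    exact ⟨p, q, ⟨hp1, hp2⟩, ⟨hq1, hq2⟩, h1, h2⟩

/-- Positivity of a kernel in terms of its form on finitely supported vectors. -/
lemma isPositiveKernel_iff {K : Kernel d} :
    IsPositiveKernel K ↔ IsHermitianKernel K ∧ ∀ f, 0 ≤ (sesqForm K f f).re := by
  constructor
  · intro h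
    have hK : IsHermitianKernel K := fun a b => by
      classical
      have := (h {a, b}).1.apply ⟨b, by simp⟩ ⟨a, by simp⟩
      simpa using this.symm
    refine ⟨hK, fun f => ?_⟩
    -- The matrix form conjugates the vector at the first index while `sesqForm` conjugates at the
    -- second, hence the conjugated test vector.
    have := (Matrix.posSemidef_iff_dotProduct_mulVec.1 (h f.support)).2 fun i => conj (f i.1)
    have h2 := (Complex.le_def.1 this).1
    suffices sesqForm K f f = star (fun i : f.support => conj (f i.1)) ⬝ᵥ
        ((Matrix.of fun α β : f.support => K α.1 β.1).mulVec fun i => conj (f i.1)) by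
      rwa [this]
    simp only [sesqForm, dotProduct, Matrix.mulVec, Finsupp.sum, Pi.star_apply, Matrix.of_apply,
      Finset.mul_sum]
    rw [← Finset.sum_coe_sort]
    refine Finset.sum_congr rfl fun a _ => ?_
    rw [← Finset.sum_coe_sort]
    refine Finset.sum_congr rfl fun b _ => ?_
    simp
    ring
  · rintro ⟨hK, h⟩ F
    refine Matrix.posSemidef_iff_dotProduct_mulVec.2 ⟨?_, fun x => ?_⟩
    · ext a b
      simp [Matrix.conjTranspose_apply, hK a.1 b.1]
    · classical
      let f : MultiIndex d →₀ ℂ := Finsupp.onFinset F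
        (fun a => if h : a ∈ F then conj (x ⟨a, h⟩) else 0) fun a ha => by
          by_contra h
          simp [h] at ha
      have hf : sesqForm K f f =
          star x ⬝ᵥ ((Matrix.of fun α β : F => K α.1 β.1).mulVec x) := by
        simp only [sesqForm, dotProduct, Matrix.mulVec, Pi.star_apply, Matrix.of_apply,
          Finset.mul_sum]
        rw [Finsupp.onFinset_sum _ (by simp), ← Finset.sum_coe_sort]
        refine Finset.sum_congr rfl fun a _ => ?_
        rw [Finsupp.onFinset_sum _ (by simp), ← Finset.sum_coe_sort]
        refine Finset.sum_congr rfl fun b _ => ?_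
        simp
        ring
      rw [← hf, ← hK.sesqForm_self_re f]
      exact_mod_cast h f

/-- Existence and uniqueness of the positive kernel with given Verblunsky coefficients and
diagonal. -/
theorem existsUnique_isKernelOf (γ : MultiIndex d → MultiIndex d → ℂ)
    (hγ : ∀ α β, Shortlex α β → ‖γ α β‖ < 1) (s : MultiIndex d → ℝ) (hs : ∀ α, 0 < s α) :
    ∃! K : Kernel d, IsKernelOf γ s K := by
  obtain ⟨K, hK⟩ := exists_kernel_of_coeff (ι := ShortlexIndex d) (γ := γ) (s := s)
    (fun a b h => hγ a b ((ShortlexIndex.lt_iff a b).1 h)) hs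
  have hpos : ∀ f : ShortlexIndex d →₀ ℂ, 0 ≤ (sesqForm K f f).re := fun f => by
    have : PosOn K (f.support : Set (ShortlexIndex d)) :=
      PosOn.of_forall_Icc f.support.finite_toSet fun a _ b _ => (hK _).pos a b le_rfl
    exact this.nonnegOn f ((Finsupp.mem_supported ℂ f).2 subset_rfl)
  refine ⟨K, ⟨isPositiveKernel_iff.2 ⟨(hK 0).hermitian, hpos⟩, fun α β h => ?_, (hK 0).diagonal⟩,
    fun K' hK' => ?_⟩
  · exact (isVerblunskyCoeff_iff K α β _).2
      ((hK _).coeff α β ((ShortlexIndex.lt_iff α β).2 h) le_rfl)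
  · obtain ⟨hherm, -⟩ := isPositiveKernel_iff.1 hK'.positive
    -- The comparison uses positivity of the constructed `K` only; of `K'` it takes hermitian
    -- symmetry, the diagonal and the coefficients.
    have key : ∀ α β : ShortlexIndex d, α ≤ β → K α β = K' α β := fun α β h =>
      eq_of_isCoeff (ι := ShortlexIndex d) (γ := γ) (n := (Finset.Icc α β).card) (hK 0).hermitian hherm
        (fun a => by rw [(hK 0).diagonal a]; exact (hK'.diagonal a).symm)
        (fun a b _ f _ => hpos f) (fun a b hab _ => (hK _).coeff a b hab le_rfl)
        (fun a b hab _ => (isVerblunskyCoeff_iff K' a b _).1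
          (hK'.coeffs a b ((ShortlexIndex.lt_iff a b).1 hab))) α β h le_rfl
    funext α β
    rcases le_total (α := ShortlexIndex d) α β with h | h
    · exact (key α β h).symm
    · rw [hherm β α, (hK 0).hermitian β α, key β α h]

/-! ### Spherical kernels and multiplication by coordinates. -/

lemma sesqForm_add_kernel {ι : Type*} (K L : ι → ι → ℂ) (p q : ι →₀ ℂ) :
    sesqForm (K + L) p q = sesqForm K p q + sesqForm L p q := by
  unfold sesqForm
  simp only [← Finsupp.sum_add, Pi.add_apply, mul_add]

lemma sesqForm_smul_kernel {ι : Type*} (c : ℂ) (K : ι → ι → ℂ) (p q : ι →₀ ℂ) :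
    sesqForm (c • K) p q = c * sesqForm K p q := by
  unfold sesqForm
  simp only [Finsupp.mul_sum, Pi.smul_apply, smul_eq_mul]
  exact Finsupp.sum_congr fun _ _ => Finsupp.sum_congr fun _ _ => by ring

/-- Multiplying a polynomial by z_j is `mapDomain` along β ↦ β + e_j; this moves the multiplication
from the polynomials to the kernel. -/
lemma sesqForm_mapDomain {ι κ : Type*} (K : κ → κ → ℂ) (φ ψ : ι → κ) (p q : ι →₀ ℂ) :
    sesqForm K (p.mapDomain φ) (q.mapDomain ψ) = sesqForm (fun a b => K (φ a) (ψ b)) p q := by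
  unfold sesqForm
  rw [Finsupp.sum_mapDomain_index (by simp)
    (fun b m n => by rw [← Finsupp.sum_add]; exact Finsupp.sum_congr fun _ _ => by ring)]
  refine Finsupp.sum_congr fun a _ => ?_
  rw [Finsupp.sum_mapDomain_index (by simp) (fun b m n => by rw [map_add]; ring)]

/-- Induction on multi-indices by incrementing one entry. -/
lemma multiIndex_induction {P : MultiIndex d → Prop} (h0 : P 0)
    (hs : ∀ α j, P α → P (α + Pi.single j 1)) (α : MultiIndex d) : P α := by
  induction hn : ∑ i, α i generalizing α with
  | zero =>
    have : α = 0 := by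
      funext i
      exact (Finset.sum_eq_zero_iff.1 hn) i (Finset.mem_univ i)
    rwa [this]
  | succ n ih =>
    obtain ⟨j, -, hj⟩ : ∃ j ∈ Finset.univ, α j ≠ 0 := by
      by_contra! h
      rw [Finset.sum_eq_zero h] at hn
      omega
    have hα : α = (α - Pi.single j 1) + Pi.single j 1 := by
      refine (tsub_add_cancel_of_le fun i => ?_).symm
      rcases eq_or_ne i j with rfl | h
      · simp; omega
      · simp [h]
    rw [hα]
    refine hs _ j (ih _ ?_)
    rw [hα] at hn
    simp only [Pi.add_apply, Finset.sum_add_distrib, Finset.sum_pi_single', Finset.mem_univ,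
      if_true] at hn
    omega

/-- Positive kernels satisfying the identity `K(α, β) = ∑ j, K(α + e_j, β + e_j)`. -/
structure IsSphericalKernel (K : Kernel d) : Prop where
  hermitian : IsHermitianKernel K
  nonneg : ∀ f, 0 ≤ (sesqForm K f f).re
  sum_shift : ∀ α β, K α β = ∑ j : Fin d, K (α + Pi.single j 1) (β + Pi.single j 1)

/-- The kernel of `(f, g) ↦ ⟨(x + y z_j) f, (x + y z_j) g⟩_K`. -/
def twistKernel (K : Kernel d) (j : Fin d) (x y : ℂ) : Kernel d := fun α β =>
  x * conj x * K α β + x * conj y * K α (β + Pi.single j 1) +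
    y * conj x * K (α + Pi.single j 1) β +
    y * conj y * K (α + Pi.single j 1) (β + Pi.single j 1)

lemma sesqForm_twistKernel (K : Kernel d) (j : Fin d) (x y : ℂ) (f : MultiIndex d →₀ ℂ) :
    sesqForm (twistKernel K j x y) f f =
      sesqForm K (x • f + y • f.mapDomain fun β => β + Pi.single j 1)
        (x • f + y • f.mapDomain fun β : MultiIndex d => β + Pi.single j 1) := by
  have h1 : ∀ A B C : Kernel d, (∀ α β, A α β = K α (β + Pi.single j 1)) →
      (∀ α β, B α β = K (α + Pi.single j 1) β) →
      (∀ α β, C α β = K (α + Pi.single j 1) (β + Pi.single j 1)) →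
      twistKernel K j x y = (x * conj x) • K + (x * conj y) • A + (y * conj x) • B +
        (y * conj y) • C := by
    intro A B C hA hB hC
    funext α β
    simp only [twistKernel, Pi.add_apply, Pi.smul_apply, smul_eq_mul, hA, hB, hC]
  have h2 := sesqForm_mapDomain K (id : MultiIndex d → MultiIndex d)
    (fun β : MultiIndex d => β + Pi.single j 1) f f
  have h3 := sesqForm_mapDomain K (fun β : MultiIndex d => β + Pi.single j 1)
    (id : MultiIndex d → MultiIndex d) f f
  have h4 := sesqForm_mapDomain K (fun β : MultiIndex d => β + Pi.single j 1)
    (fun β : MultiIndex d => β + Pi.single j 1) f f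
  rw [Finsupp.mapDomain_id] at h2 h3
  simp only [id_eq] at h2 h3
  rw [h1 _ _ _ (fun _ _ => rfl) (fun _ _ => rfl) (fun _ _ => rfl)]
  rw [sesqForm_add_kernel, sesqForm_add_kernel, sesqForm_add_kernel, sesqForm_smul_kernel,
    sesqForm_smul_kernel, sesqForm_smul_kernel, sesqForm_smul_kernel, ← h2, ← h3, ← h4]
  generalize (f.mapDomain fun β : MultiIndex d => β + Pi.single j 1) = g
  rw [sesqForm_add_left, sesqForm_add_right, sesqForm_add_right, sesqForm_smul_left,
    sesqForm_smul_left, sesqForm_smul_left, sesqForm_smul_left, sesqForm_smul_right,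
    sesqForm_smul_right, sesqForm_smul_right, sesqForm_smul_right]
  ring

namespace IsSphericalKernel

variable {K L : Kernel d}

lemma zero : IsSphericalKernel (0 : Kernel d) :=
  ⟨fun _ _ => by simp, fun f => by simp [sesqForm], fun _ _ => by simp⟩

lemma add (hK : IsSphericalKernel K) (hL : IsSphericalKernel L) : IsSphericalKernel (K + L) where
  hermitian a b := by simp [hK.hermitian a b, hL.hermitian a b]
  nonneg f := by
    rw [sesqForm_add_kernel, Complex.add_re]
    exact add_nonneg (hK.nonneg f) (hL.nonneg f)
  sum_shift α β := by
    simp only [Pi.add_apply, Finset.sum_add_distrib, ← hK.sum_shift, ← hL.sum_shift]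

lemma smul (hK : IsSphericalKernel K) {c : ℝ} (hc : 0 ≤ c) :
    IsSphericalKernel ((c : ℂ) • K) where
  hermitian a b := by simp [hK.hermitian a b]
  nonneg f := by
    rw [sesqForm_smul_kernel, Complex.re_ofReal_mul]
    exact mul_nonneg hc (hK.nonneg f)
  sum_shift α β := by
    simp only [Pi.smul_apply, smul_eq_mul, ← Finset.mul_sum, ← hK.sum_shift]

lemma sum {κ : Type*} (s : Finset κ) {F : κ → Kernel d}
    (hF : ∀ k ∈ s, IsSphericalKernel (F k)) : IsSphericalKernel (∑ k ∈ s, F k) := by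
  classical
  induction s using Finset.induction_on with
  | empty => simpa using zero
  | insert a s ha ih =>
    rw [Finset.sum_insert ha]
    exact (hF a (Finset.mem_insert_self a s)).add
      (ih fun k hk => hF k (Finset.mem_insert_of_mem hk))

lemma apply_self_nonneg (hK : IsSphericalKernel K) (α : MultiIndex d) : 0 ≤ (K α α).re := by
  have := hK.nonneg (Finsupp.single α 1)
  simpa using this

/-- By the recurrence K(α + e_j, α + e_j) is one of the nonnegative summands of K(α, α), so the
diagonal decreases under shifts. -/
lemma apply_self_le (hK : IsSphericalKernel K) (α : MultiIndex d) :
    (K α α).re ≤ (K 0 0).re := by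
  induction α using multiIndex_induction with
  | h0 => exact le_rfl
  | hs α j ih =>
    refine le_trans ?_ ih
    rw [hK.sum_shift α α, Complex.re_sum]
    exact Finset.single_le_sum
      (f := fun j : Fin d => (K (α + Pi.single j 1) (α + Pi.single j 1)).re)
      (fun i _ => hK.apply_self_nonneg _) (Finset.mem_univ j)

/-- Testing positivity on z^α - u z^β, with u the phase of K(α, β), gives 2|K(α, β)| ≤ K(α, α) +
K(β, β). The bound drives both compactness and the vanishing of kernels with K(0, 0) = 0. -/
lemma norm_le (hK : IsSphericalKernel K) (α β : MultiIndex d) : ‖K α β‖ ≤ (K 0 0).re := by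
  rcases eq_or_ne (K α β) 0 with h0 | h0
  · rw [h0, norm_zero]
    exact hK.apply_self_nonneg 0
  obtain ⟨u, hu⟩ : ∃ u, u = K α β / ‖K α β‖ := ⟨_, rfl⟩
  have hn : (‖K α β‖ : ℂ) ≠ 0 := by exact_mod_cast norm_ne_zero_iff.2 h0
  have hu1 : u * conj u = 1 := by
    rw [Complex.mul_conj', hu]
    simp [norm_ne_zero_iff.2 h0]
  have huK : conj u * K α β = ‖K α β‖ := by
    rw [hu, map_div₀, Complex.conj_ofReal, div_mul_eq_mul_div, Complex.conj_mul', pow_two,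
      mul_div_cancel_right₀ _ hn]
  have huK' : u * conj (K α β) = ‖K α β‖ := by
    have := congrArg conj huK
    simpa using this
  have h := hK.nonneg (Finsupp.single α 1 - Finsupp.single β u)
  simp only [sesqForm_sub_left, sesqForm_sub_right, sesqForm_single, hK.hermitian α β, map_one,
    mul_one, one_mul, hu1, huK, huK'] at h
  simp at h
  have h1 := hK.apply_self_le α
  have h2 := hK.apply_self_le β
  linarith

lemma twist (hK : IsSphericalKernel K) (j : Fin d) (x y : ℂ) :
    IsSphericalKernel (twistKernel K j x y) where
  hermitian a b := by
    simp only [twistKernel, map_add, map_mul, Complex.conj_conj]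
    rw [hK.hermitian a b, hK.hermitian a (b + Pi.single j 1),
      hK.hermitian (a + Pi.single j 1) b, hK.hermitian (a + Pi.single j 1) (b + Pi.single j 1)]
    ring
  nonneg f := by
    rw [sesqForm_twistKernel]
    exact hK.nonneg _
  sum_shift α β := by
    simp only [twistKernel, Finset.sum_add_distrib, ← Finset.mul_sum]
    rw [hK.sum_shift α β, hK.sum_shift α (β + Pi.single j 1),
      hK.sum_shift (α + Pi.single j 1) β, hK.sum_shift (α + Pi.single j 1) (β + Pi.single j 1)]
    simp only [add_right_comm _ (Pi.single j 1 : MultiIndex d)]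

/-- `K` minus the kernel obtained by multiplication with `z_j` is again spherical. -/
lemma sub_twist (hK : IsSphericalKernel K) (j : Fin d) :
    IsSphericalKernel (K - twistKernel K j 0 1) := by
  -- The recurrence writes `K` as the sum over all k of its twists by z_k; removing the j-th leaves
  -- a sum of spherical kernels.
  have h : K - twistKernel K j 0 1 =
      ∑ k ∈ Finset.univ.erase j, twistKernel K k 0 1 := by
    rw [Finset.sum_erase_eq_sub (Finset.mem_univ j)]
    congr 1
    funext α β
    rw [hK.sum_shift α β]
    simp [twistKernel, Finset.sum_apply]
  rw [h]
  exact sum _ fun k _ => hK.twist k 0 1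

end IsSphericalKernel

/-! ### The compact convex set of normalized spherical kernels and its extreme points. -/

/-- The normalized spherical kernels. -/
def sphericalStates (d : ℕ) : Set (Kernel d) := {K | IsSphericalKernel K ∧ K 0 0 = 1}

lemma isCompact_sphericalStates (d : ℕ) : IsCompact (sphericalStates d) := by
  have hB : IsCompact (Set.univ.pi fun _ : MultiIndex d => Set.univ.pi fun _ : MultiIndex d =>
      Metric.closedBall (0 : ℂ) 1) :=
    isCompact_univ_pi fun _ => isCompact_univ_pi fun _ => isCompact_closedBall 0 1
  refine hB.of_isClosed_subset ?_ ?_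
  · have hap : ∀ α β : MultiIndex d, Continuous fun K : Kernel d => K α β := fun α β =>
      (continuous_apply β).comp (continuous_apply α)
    have hset : sphericalStates d =
        (⋂ (α : MultiIndex d) (β : MultiIndex d), {K : Kernel d | K β α = conj (K α β)}) ∩
        (⋂ f : MultiIndex d →₀ ℂ, {K : Kernel d | 0 ≤ (sesqForm K f f).re}) ∩
        (⋂ (α : MultiIndex d) (β : MultiIndex d), {K : Kernel d | K α β =
          ∑ j : Fin d, K (α + Pi.single j 1) (β + Pi.single j 1)}) ∩
        {K : Kernel d | K 0 0 = 1} := by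
      ext K
      simp only [Set.mem_inter_iff, Set.mem_iInter, Set.mem_ofPred_eq]
      exact ⟨fun h => ⟨⟨⟨h.1.1, h.1.2⟩, h.1.3⟩, h.2⟩, fun h => ⟨⟨h.1.1.1, h.1.1.2, h.1.2⟩, h.2⟩⟩
    rw [hset]
    refine IsClosed.inter (IsClosed.inter (IsClosed.inter ?_ ?_) ?_) ?_
    · exact isClosed_iInter fun α => isClosed_iInter fun β =>
        isClosed_eq (hap β α) (Complex.continuous_conj.comp (hap α β))
    · refine isClosed_iInter fun f => isClosed_le continuous_const
        (Complex.continuous_re.comp ?_)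
      exact continuous_finsetSum _ fun a _ => continuous_finsetSum _ fun b _ =>
        continuous_const.mul (hap a b)
    · exact isClosed_iInter fun α => isClosed_iInter fun β =>
        isClosed_eq (hap α β) (continuous_finsetSum _ fun j _ => hap _ _)
    · exact isClosed_eq (hap 0 0) continuous_const
  · intro K hK α _ β _
    have := hK.1.norm_le α β
    rw [hK.2] at this
    simpa using this

lemma convex_sphericalStates (d : ℕ) : Convex ℝ (sphericalStates d) := by
  intro K hK L hL a b ha hb hab
  have h : ∀ (c : ℝ) (M : Kernel d), c • M = (c : ℂ) • M := fun c M => by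
    funext α β
    simp
  refine ⟨?_, ?_⟩
  · rw [h, h]
    exact (hK.1.smul ha).add (hL.1.smul hb)
  · simp only [Pi.add_apply, Pi.smul_apply, hK.2, hL.2, Complex.real_smul, mul_one]
    exact_mod_cast hab

/-- A spherical kernel dominated by an extreme point is a multiple of it. -/
lemma eq_smul_of_mem_extremePoints {K A B : Kernel d}
    (hK : K ∈ (sphericalStates d).extremePoints ℝ) (hA : IsSphericalKernel A)
    (hB : IsSphericalKernel B) (hAB : A + B = K) : ∃ c : ℂ, A = c • K := by
  have h00 : A 0 0 + B 0 0 = 1 := by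
    have := congrFun (congrFun hAB 0) 0
    rwa [Pi.add_apply, Pi.add_apply, hK.1.2] at this
  have hvanish : ∀ C : Kernel d, IsSphericalKernel C → (C 0 0).re = 0 → C = 0 := by
    intro C hC h
    funext α β
    have := hC.norm_le α β
    rw [h] at this
    exact norm_le_zero_iff.1 this
  have hre : ∀ C : Kernel d, IsSphericalKernel C → ((C 0 0).re : ℂ) = C 0 0 := fun C hC =>
    Complex.ext rfl (by simp [hC.hermitian.apply_self_im 0])
  rcases (hA.apply_self_nonneg 0).eq_or_lt with ha | ha
  · exact ⟨0, by rw [hvanish A hA ha.symm, zero_smul]⟩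
  rcases (hB.apply_self_nonneg 0).eq_or_lt with hb | hb
  · exact ⟨1, by rw [one_smul, ← hAB, hvanish B hB hb.symm, add_zero]⟩
  have hnorm : ∀ C : Kernel d, IsSphericalKernel C → 0 < (C 0 0).re →
      (((C 0 0).re⁻¹ : ℝ) : ℂ) • C ∈ sphericalStates d := by
    intro C hC hpos
    refine ⟨hC.smul (inv_nonneg.2 hpos.le), ?_⟩
    have h := hre C hC
    have hne : C 0 0 ≠ 0 := fun h0 => by simp [h0] at hpos
    simp only [Pi.smul_apply, smul_eq_mul, Complex.ofReal_inv]
    rw [h, inv_mul_cancel₀ hne]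
  have hcancel : ∀ C : Kernel d, 0 < (C 0 0).re →
      (C 0 0).re • ((((C 0 0).re⁻¹ : ℝ) : ℂ) • C) = C := by
    intro C hpos
    have hne : ((C 0 0).re : ℂ) ≠ 0 := by exact_mod_cast hpos.ne'
    funext α β
    simp only [Pi.smul_apply, smul_eq_mul, Complex.real_smul, Complex.ofReal_inv]
    rw [mul_inv_cancel_left₀ hne]
  -- `K` is the convex combination of the normalized `A` and `B` with weights A(0, 0) and B(0, 0),
  -- so extremality identifies the normalized `A` with `K`.
  have hseg := hK.2 (hnorm A hA ha) (hnorm B hB hb)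
    ⟨(A 0 0).re, (B 0 0).re, ha, hb, by
      have := congrArg Complex.re h00
      simpa using this, by rw [hcancel A ha, hcancel B hb, hAB]⟩
  refine ⟨((A 0 0).re : ℂ), ?_⟩
  rw [← hseg]
  funext α β
  exact congrFun (congrFun (hcancel A ha).symm α) β

/-- Shifting the first index of an extreme spherical kernel multiplies it by a scalar. -/
lemma exists_shift_eq_mul {K : Kernel d} (hK : K ∈ (sphericalStates d).extremePoints ℝ)
    (j : Fin d) : ∃ l : ℂ, ∀ α β, K (α + Pi.single j 1) β = l * K α β := by
  have hS := hK.1.1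
  have h1 : ∃ c : ℂ, twistKernel K j 0 1 = c • K :=
    eq_smul_of_mem_extremePoints hK (hS.twist j 0 1) (hS.sub_twist j) (add_sub_cancel _ _)
  -- By the parallelogram law the twists by 1 + u z_j and 1 - u z_j add up to 2K + 2T, with T the
  -- twist by z_j. A quarter of this plus (K - T)/2 is `K`, so each quarter is dominated by `K`.
  have h2 : ∀ u : ℂ, u * conj u = 1 →
      ∃ c : ℂ, ((1 / 4 : ℝ) : ℂ) • twistKernel K j 1 u = c • K := by
    intro u hu
    refine eq_smul_of_mem_extremePoints hK ((hS.twist j 1 u).smul (by norm_num))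
      (((hS.twist j 1 (-u)).smul (c := 1 / 4) (by norm_num)).add
        ((hS.sub_twist j).smul (c := 1 / 2) (by norm_num))) ?_
    funext α β
    simp only [twistKernel, Pi.add_apply, Pi.sub_apply, Pi.smul_apply, smul_eq_mul,
      map_neg, map_one, map_zero, neg_mul_neg, hu]
    push_cast
    ring
  obtain ⟨c, hc⟩ := h1
  obtain ⟨t, ht⟩ := h2 1 (by simp)
  obtain ⟨u, hu⟩ := h2 Complex.I (by simp)
  -- Polarization: adding -i times the identity for the phase i to the one for the phase 1 cancels
  -- K(α, β + e_j) and leaves 2K(α + e_j, β).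
  refine ⟨2 * t - 2 * Complex.I * u - (1 + c) * (1 - Complex.I) / 2, fun α β => ?_⟩
  have e0 := congrFun (congrFun hc α) β
  have e1 := congrFun (congrFun ht α) β
  have e2 := congrFun (congrFun hu α) β
  simp only [twistKernel, Pi.smul_apply, smul_eq_mul, map_one, map_zero,
    Complex.conj_I] at e0 e1 e2
  push_cast at e1 e2
  linear_combination 2 * e1 - 2 * Complex.I * e2 - (1 - Complex.I) / 2 * e0 -
    (K α (β + Pi.single j 1) / 2 - K (α + Pi.single j 1) β / 2 +
      Complex.I * K (α + Pi.single j 1) (β + Pi.single j 1) / 2) * Complex.I_mul_I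

/-! ### Moment kernels of measures on the sphere. -/

lemma monomial_zero (ζ : UnitSphere d) : monomial 0 ζ = 1 := by simp [monomial]

lemma monomial_add (α β : MultiIndex d) (ζ : UnitSphere d) :
    monomial (α + β) ζ = monomial α ζ * monomial β ζ := by
  simp [monomial, pow_add, Finset.prod_mul_distrib]

lemma monomial_single (j : Fin d) (ζ : UnitSphere d) :
    monomial (Pi.single j 1) ζ = (ζ : EuclideanSpace ℂ (Fin d)) j := by
  rw [monomial, Finset.prod_eq_single j]
  · simp
  · intro i _ hij
    simp [hij]
  · simp

lemma continuous_monomial (α : MultiIndex d) : Continuous (monomial (d := d) α) := by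
  unfold monomial
  fun_prop

lemma sum_mul_conj (ζ : UnitSphere d) : ∑ j : Fin d,
    (ζ : EuclideanSpace ℂ (Fin d)) j * conj ((ζ : EuclideanSpace ℂ (Fin d)) j) = 1 := by
  have h : ‖(ζ : EuclideanSpace ℂ (Fin d))‖ ^ 2 = 1 := by
    rw [mem_sphere_zero_iff_norm.1 ζ.2, one_pow]
  rw [EuclideanSpace.norm_sq_eq] at h
  simp only [Complex.mul_conj']
  exact_mod_cast h

/-- The function `ζ ↦ ζ^α conj(ζ^β)` as a bounded continuous function on the sphere. -/
noncomputable def monomialBCF (α β : MultiIndex d) :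
    BoundedContinuousFunction (UnitSphere d) ℂ :=
  BoundedContinuousFunction.mkOfCompact ⟨fun ζ => monomial α ζ * conj (monomial β ζ),
    (continuous_monomial α).mul (Complex.continuous_conj.comp (continuous_monomial β))⟩

@[simp] lemma monomialBCF_apply (α β : MultiIndex d) (ζ : UnitSphere d) :
    monomialBCF α β ζ = monomial α ζ * conj (monomial β ζ) := rfl

lemma integrable_monomial (μ : Measure (UnitSphere d)) [IsFiniteMeasure μ]
    (α β : MultiIndex d) : Integrable (fun ζ => monomial α ζ * conj (monomial β ζ)) μ :=
  (monomialBCF α β).integrable μ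

/-- The form at a polynomial is the integral of its squared modulus, and the recurrence is ∑ |ζ_j|²
= 1 under the integral. -/
lemma isSphericalKernel_momentKernel (μ : Measure (UnitSphere d)) [IsFiniteMeasure μ] :
    IsSphericalKernel (momentKernel μ) where
  hermitian α β := by
    simp only [momentKernel, ← integral_conj, map_mul, Complex.conj_conj]
    exact integral_congr_ae (.of_forall fun ζ => mul_comm _ _)
  nonneg f := by
    have h : sesqForm (momentKernel μ) f f =
        ∫ ζ, ((‖f.sum fun α a => a * monomial α ζ‖ ^ 2 : ℝ) : ℂ) ∂μ := by
      have h1 : ∀ ζ : UnitSphere d, ((‖f.sum fun α a => a * monomial α ζ‖ ^ 2 : ℝ) : ℂ) =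
          ∑ α ∈ f.support, ∑ β ∈ f.support,
            f α * conj (f β) * (monomial α ζ * conj (monomial β ζ)) := by
        intro ζ
        rw [Complex.ofReal_pow, ← Complex.mul_conj', Finsupp.sum, map_sum, Finset.sum_mul_sum]
        refine Finset.sum_congr rfl fun α _ => Finset.sum_congr rfl fun β _ => ?_
        rw [map_mul]
        ring
      simp only [h1]
      rw [integral_finsetSum _ fun α _ => integrable_finsetSum _ fun β _ =>
        (integrable_monomial μ α β).const_mul _]
      refine Finset.sum_congr rfl fun α _ => ?_
      rw [integral_finsetSum _ fun β _ => (integrable_monomial μ α β).const_mul _]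
      refine Finset.sum_congr rfl fun β _ => ?_
      rw [integral_const_mul]
      rfl
    rw [h, integral_complex_ofReal, Complex.ofReal_re]
    exact integral_nonneg fun ζ => by positivity
  sum_shift α β := by
    simp only [momentKernel]
    rw [← integral_finsetSum _ fun j _ => integrable_monomial μ _ _]
    refine integral_congr_ae (.of_forall fun ζ => ?_)
    simp only [monomial_add, monomial_single, map_mul]
    have : ∀ j : Fin d, monomial α ζ * (ζ : EuclideanSpace ℂ (Fin d)) j *
        (conj (monomial β ζ) * conj ((ζ : EuclideanSpace ℂ (Fin d)) j)) =
        monomial α ζ * conj (monomial β ζ) * ((ζ : EuclideanSpace ℂ (Fin d)) j *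
          conj ((ζ : EuclideanSpace ℂ (Fin d)) j)) := fun j => by ring
    simp only [this, ← Finset.mul_sum, sum_mul_conj, mul_one]

/-- Extreme points of the normalized spherical kernels are point evaluations. -/
lemma exists_eq_dirac {K : Kernel d} (hK : K ∈ (sphericalStates d).extremePoints ℝ) :
    ∃ ζ : UnitSphere d, K = momentKernel (Measure.dirac ζ) := by
  choose l hl using exists_shift_eq_mul hK
  have hS := hK.1.1
  have hl' : ∀ j α β, K α (β + Pi.single j 1) = conj (l j) * K α β := fun j α β => by
    rw [hS.hermitian, hl, map_mul, ← hS.hermitian]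
  -- The recurrence at (0, 0) puts the vector of multipliers on the unit sphere.
  have hnorm : ∑ j, l j * conj (l j) = 1 := by
    have := hS.sum_shift 0 0
    simp only [hl, hl', hK.1.2, mul_one] at this
    exact this.symm
  let z : EuclideanSpace ℂ (Fin d) := WithLp.toLp 2 l
  have hz : ‖z‖ = 1 := by
    have h2 : ‖z‖ ^ 2 = 1 := by
      rw [EuclideanSpace.norm_sq_eq]
      simp only [Complex.mul_conj'] at hnorm
      exact_mod_cast hnorm
    nlinarith [norm_nonneg z]
  refine ⟨⟨z, mem_sphere_zero_iff_norm.2 hz⟩, ?_⟩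
  funext α β
  simp only [momentKernel, integral_dirac]
  set ζ : UnitSphere d := ⟨z, mem_sphere_zero_iff_norm.2 hz⟩
  have hζ : ∀ j, (ζ : EuclideanSpace ℂ (Fin d)) j = l j := fun j => rfl
  have h0 : ∀ β, K 0 β = conj (monomial β ζ) := by
    intro β
    induction β using multiIndex_induction with
    | h0 => rw [monomial_zero, map_one, hK.1.2]
    | hs β j ih => rw [hl', ih, monomial_add, monomial_single, hζ, map_mul, mul_comm]
  induction α using multiIndex_induction with
  | h0 => rw [monomial_zero, one_mul, h0]
  | hs α j ih => rw [hl, ih, monomial_add, monomial_single, hζ]; ring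

/-! ### Representing measures by Krein–Milman, and their uniqueness. -/

/-- Moment kernels of probability measures. -/
def probabilityMomentKernels (d : ℕ) : Set (Kernel d) :=
  Set.range fun P : ProbabilityMeasure (UnitSphere d) => momentKernel (P : Measure (UnitSphere d))

/-- Probability measures on the compact sphere are weakly compact, and each moment is the integral
of a continuous function. -/
lemma isCompact_probabilityMomentKernels (d : ℕ) : IsCompact (probabilityMomentKernels d) := by
  refine isCompact_range (continuous_pi fun α => continuous_pi fun β => ?_)
  rw [continuous_iff_continuousAt]
  intro P
  exact (ProbabilityMeasure.tendsto_iff_forall_integral_rclike_tendsto ℂ).1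
    (Filter.tendsto_id (α := ProbabilityMeasure (UnitSphere d))) (monomialBCF α β)

lemma momentKernel_add (μ ν : Measure (UnitSphere d)) [IsFiniteMeasure μ] [IsFiniteMeasure ν] :
    momentKernel (μ + ν) = momentKernel μ + momentKernel ν := by
  funext α β
  exact integral_add_measure (integrable_monomial μ α β) (integrable_monomial ν α β)

lemma momentKernel_smul (μ : Measure (UnitSphere d)) {c : ℝ} (hc : 0 ≤ c) :
    momentKernel (ENNReal.ofReal c • μ) = c • momentKernel μ := by
  funext α β
  simp only [momentKernel, integral_smul_measure, ENNReal.toReal_ofReal hc, Pi.smul_apply]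

lemma convex_probabilityMomentKernels (d : ℕ) : Convex ℝ (probabilityMomentKernels d) := by
  rintro _ ⟨P, rfl⟩ _ ⟨Q, rfl⟩ a b ha hb hab
  have hfin : ∀ (c : ℝ) (R : ProbabilityMeasure (UnitSphere d)),
      IsFiniteMeasure (ENNReal.ofReal c • (R : Measure (UnitSphere d))) := fun c R =>
    Measure.smul_finite _ ENNReal.ofReal_ne_top
  have := hfin a P
  have := hfin b Q
  refine ⟨⟨ENNReal.ofReal a • (P : Measure (UnitSphere d)) +
    ENNReal.ofReal b • (Q : Measure (UnitSphere d)), ⟨?_⟩⟩, ?_⟩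
  · simp only [Measure.add_apply, Measure.smul_apply, measure_univ, smul_eq_mul, mul_one]
    rw [← ENNReal.ofReal_add ha hb, hab, ENNReal.ofReal_one]
  · simp only [ProbabilityMeasure.coe_mk]
    rw [momentKernel_add, momentKernel_smul _ ha, momentKernel_smul _ hb]

/-- Every spherical kernel is the moment kernel of a finite measure on the sphere. -/
lemma IsSphericalKernel.exists_momentKernel_eq {K : Kernel d} (hK : IsSphericalKernel K)
    (h0 : 0 < (K 0 0).re) :
    ∃ μ : Measure (UnitSphere d), IsFiniteMeasure μ ∧ momentKernel μ = K := by
  have hre : ((K 0 0).re : ℂ) = K 0 0 :=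
    Complex.ext rfl (by simp [hK.hermitian.apply_self_im 0])
  have hne : K 0 0 ≠ 0 := fun h => by simp [h] at h0
  have hmem : (((K 0 0).re⁻¹ : ℝ) : ℂ) • K ∈ sphericalStates d := by
    refine ⟨hK.smul (inv_nonneg.2 h0.le), ?_⟩
    simp only [Pi.smul_apply, smul_eq_mul, Complex.ofReal_inv]
    rw [hre, inv_mul_cancel₀ hne]
  rw [← closure_convexHull_extremePoints (isCompact_sphericalStates d)
    (convex_sphericalStates d)] at hmem
  have hsub : closure (convexHull ℝ ((sphericalStates d).extremePoints ℝ)) ⊆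
      probabilityMomentKernels d := by
    refine closure_minimal (convexHull_min ?_ (convex_probabilityMomentKernels d))
      (isCompact_probabilityMomentKernels d).isClosed
    intro L hL
    obtain ⟨ζ, rfl⟩ := exists_eq_dirac hL
    exact ⟨⟨Measure.dirac ζ, inferInstance⟩, rfl⟩
  obtain ⟨P, hP⟩ := hsub hmem
  refine ⟨ENNReal.ofReal (K 0 0).re • (P : Measure (UnitSphere d)),
    Measure.smul_finite _ ENNReal.ofReal_ne_top, ?_⟩
  rw [momentKernel_smul _ h0.le]
  simp only at hP
  rw [hP]
  funext α β
  simp only [Pi.smul_apply, smul_eq_mul, Complex.real_smul, Complex.ofReal_inv]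
  rw [hre, mul_inv_cancel_left₀ hne]

/-- A finite measure on the sphere is determined by its moment kernel. -/
lemma eq_of_momentKernel_eq {μ ν : Measure (UnitSphere d)} [IsFiniteMeasure μ]
    [IsFiniteMeasure ν] (h : momentKernel μ = momentKernel ν) : μ = ν := by
  let S : Set (BoundedContinuousFunction (UnitSphere d) ℂ) :=
    -- The coordinate functions separate points, and the star algebra they generate is spanned by
    -- the functions ζ^α conj(ζ^β), whose integrals are the entries of the moment kernel.
    Set.range fun j : Fin d => monomialBCF (Pi.single j 1) 0
  let A := StarAlgebra.adjoin ℂ S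
  have hstar : ∀ α β : MultiIndex d, star (monomialBCF α β) = monomialBCF β α := fun α β => by
    ext ζ
    simp [mul_comm]
  have hmon : ∀ g ∈ Submonoid.closure (S ∪ star S), ∃ α β : MultiIndex d,
      g = monomialBCF α β := by
    intro g hg
    induction hg using Submonoid.closure_induction with
    | mem g hg =>
      rcases hg with ⟨j, rfl⟩ | ⟨j, hj⟩
      · exact ⟨_, _, rfl⟩
      · exact ⟨_, _, by rw [← star_star g, ← hj, hstar]⟩
    | one => exact ⟨0, 0, by ext ζ; simp [monomial_zero]⟩
    | mul g g' _ _ hg hg' =>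
      obtain ⟨α, β, rfl⟩ := hg
      obtain ⟨α', β', rfl⟩ := hg'
      refine ⟨α + α', β + β', ?_⟩
      ext ζ
      simp only [BoundedContinuousFunction.mul_apply, monomialBCF_apply, monomial_add, map_mul]
      ring
  refine ext_of_forall_mem_subalgebra_integral_eq_of_pseudoEMetric_complete_countable
    (𝕜 := ℂ) (A := A) ?_ ?_
  · intro x y hxy
    obtain ⟨j, hj⟩ : ∃ j, (x : EuclideanSpace ℂ (Fin d)) j ≠
        (y : EuclideanSpace ℂ (Fin d)) j := by
      by_contra! hall
      exact hxy (Subtype.ext (PiLp.ext hall))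
    refine ⟨_, ⟨_, ⟨monomialBCF (Pi.single j 1) 0,
      StarAlgebra.subset_adjoin ℂ S ⟨j, rfl⟩, rfl⟩, rfl⟩, ?_⟩
    simpa [monomial_zero, monomial_single] using hj
  · intro g hg
    have hg' : g ∈ Submodule.span ℂ
        (Submonoid.closure (S ∪ star S) : Set (BoundedContinuousFunction (UnitSphere d) ℂ)) := by
      rw [← Algebra.adjoin_eq_span]
      exact hg
    clear hg
    induction hg' using Submodule.span_induction with
    | mem g hg =>
      obtain ⟨α, β, rfl⟩ := hmon g hg
      exact congrFun (congrFun h α) β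
    | zero => simp
    | add g g' _ _ hg hg' =>
      simp only [BoundedContinuousFunction.coe_add, Pi.add_apply]
      rw [integral_add (g.integrable μ) (g'.integrable μ),
        integral_add (g.integrable ν) (g'.integrable ν), hg, hg']
    | smul c g _ hg =>
      simp only [BoundedContinuousFunction.coe_smul, integral_smul, hg]

lemma momentKernel_self (μ : Measure (UnitSphere d)) (α : MultiIndex d) :
    momentKernel μ α α = ((∫ ζ, ‖monomial α ζ‖ ^ 2 ∂μ : ℝ) : ℂ) := by
  rw [← integral_complex_ofReal]
  simp only [momentKernel, Complex.mul_conj', Complex.ofReal_pow]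

lemma HasVerblunskyData.isKernelOf {γ : MultiIndex d → MultiIndex d → ℂ} {s : MultiIndex d → ℝ}
    {μ : Measure (UnitSphere d)} (h : HasVerblunskyData γ s μ) :
    IsKernelOf γ s (momentKernel μ) := by
  have := h.finite
  have hS := isSphericalKernel_momentKernel μ
  exact ⟨isPositiveKernel_iff.2 ⟨hS.hermitian, hS.nonneg⟩, h.coeffs, fun α => by
    rw [momentKernel_self, h.diagonal]⟩

lemma IsKernelOf.hasVerblunskyData {γ : MultiIndex d → MultiIndex d → ℂ} {s : MultiIndex d → ℝ}
    {μ : Measure (UnitSphere d)} [IsFiniteMeasure μ] (h : IsKernelOf γ s (momentKernel μ)) :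
    HasVerblunskyData γ s μ :=
  ⟨inferInstance, h.coeffs, fun α => by
    have := h.diagonal α
    rw [momentKernel_self] at this
    exact_mod_cast this⟩

end SphereVerblunsky

theorem mainTheorem6 {d : ℕ}
    (γ : SphereVerblunsky.MultiIndex d → SphereVerblunsky.MultiIndex d → ℂ)
    (hγ : ∀ α β, SphereVerblunsky.Shortlex α β → ‖γ α β‖ < 1)
    (s : SphereVerblunsky.MultiIndex d → ℝ) (hs : ∀ α, 0 < s α) :
    (∃! K : SphereVerblunsky.Kernel d, SphereVerblunsky.IsKernelOf γ s K) ∧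
    ∀ K : SphereVerblunsky.Kernel d, SphereVerblunsky.IsKernelOf γ s K →
      ((∃! μ : MeasureTheory.Measure (SphereVerblunsky.UnitSphere d),
          SphereVerblunsky.HasVerblunskyData γ s μ) ↔
        ∀ α β, K α β = ∑ j : Fin d, K (α + Pi.single j 1) (β + Pi.single j 1)) ∧
      ∀ μ : MeasureTheory.Measure (SphereVerblunsky.UnitSphere d),
        SphereVerblunsky.HasVerblunskyData γ s μ → SphereVerblunsky.momentKernel μ = K := by
  have hex := SphereVerblunsky.existsUnique_isKernelOf γ hγ s hs
  refine ⟨hex, fun K hK => ?_⟩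
  -- The moment kernel of a solution has the same coefficients and diagonal as `K`, so uniqueness of
  -- the kernel identifies them. Both directions of the equivalence rest on this.
  have hmom : ∀ μ : MeasureTheory.Measure (SphereVerblunsky.UnitSphere d),
      SphereVerblunsky.HasVerblunskyData γ s μ → SphereVerblunsky.momentKernel μ = K :=
    fun μ hμ => hex.unique hμ.isKernelOf hK
  refine ⟨⟨?_, fun hrec => ?_⟩, hmom⟩
  · rintro ⟨μ, hμ, -⟩
    have := hμ.finite
    rw [← hmom μ hμ]
    exact (SphereVerblunsky.isSphericalKernel_momentKernel μ).sum_shift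
  · obtain ⟨hherm, hpos⟩ := SphereVerblunsky.isPositiveKernel_iff.1 hK.positive
    have hS : SphereVerblunsky.IsSphericalKernel K := ⟨hherm, hpos, hrec⟩
    obtain ⟨μ, hfin, rfl⟩ := hS.exists_momentKernel_eq (by
      rw [hK.diagonal 0, Complex.ofReal_re]
      exact hs 0)
    refine ⟨μ, hK.hasVerblunskyData, fun ν hν => ?_⟩
    have := hν.finite
    exact SphereVerblunsky.eq_of_momentKernel_eq (hmom ν hν)
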